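/- Let $\mathcal S$ be a finite set, let $(X,S,Y)$ be a random element of $\mathbb R^d\times\mathcal S\times\mathbb R$ with an arbitrary joint law $\mathbb P$ such that $p_s:=\mathbb P(S=s)>0$ for all $s\in\mathcal S$, and let $\alpha\in\mathbb R$, $p\in[0,1]$, $\xi>0$, $\sigma>0$, $n\ge 0$, $N\ge 1$. Data: $\mathcal D_n$ consists of $n$ i.i.d. copies of $(X,S,Y)$, and $\hat f(x,s)$ is any base estimator, that is, any measurable function of $(\mathcal D_n,x,s)$. The unlabeled sample consists of $N$ i.i.d. copies $(X_i,S_i)$ of $(X,S)$; $N_s$ is the (random) number of $i$ with $S_i=s$, and $\hat p_s=N_s/N$. The jitters $\varepsilon_1,\dots,\varepsilon_N$ are i.i.d. uniform on $[-\sigma,\sigma]$. Labeled data, unlabeled data and jitters are independent; together they form $\mathcal D$. The observations of each group $s$ are split by a fixed rule, which depends only on $s$, on $N_s$ and on the position within the group, into two halves (whose sizes differ by one if $N_s$ is odd). Let $\hat F_{\hat f|s}$ be the empirical distribution function of the values $\hat f(X_i,s)+\varepsilon_i$ over the first half, and $\hat Q_{\hat f|s}$ the empirical quantile function $y\mapsto\inf\{t: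 \hat F(t)\ge y\}$ of these values over the second half (at level $y=0$, the smallest value). The conventions for empty halves are $\hat F_{\hat f|s}=0$ and $\hat Q_{\hat f|s}=0$. Put $$\hat Q^\xi_s(y)=\begin{cases}\min\{\alpha,\hat Q_{\hat f|s}(y)\}, & y\in[0,p],\\ \max\bigl\{\alpha+\xi,\ \sum_{s'\in\mathcal S}\hat p_{s'}\hat Q_{\hat f|s'}(y)\bigr\}, & y\in(p,1],\end{cases}\qquad \hat g^\xi_{\alpha,p}(x,s)=\hat Q^\xi_s\bigl(\hat F_{\hat f|s}(\hat f(x,s)+\varepsilon_s)\bigr),$$ where $\varepsilon_s$ is a fresh jitter, uniform on $[-\sigma,\sigma]$ and independent of everything else. For $g=\hat g^\xi_{\alpha,p}$ and for fixed data $\mathcal D$ let $\mathbb P_{X|S=s}(g(X,S)\le t)$ denote the probability, over $X$ drawn from its law given $S=s$ and over the fresh jitter $\varepsilon_s$, that $g(X,s)\le t$, and let $$\mathcal U^\alpha(g)=\sup_{s,s'\in\mathcal S}\ \sup_{t\ge\alpha}\ \bigl|\mathbb P_{X|S=s}(g(X,S)\le t)-\mathbb P_{X|S=s'}(g(X,S)\le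 t)\bigr| .$$ Then there are a constant $C>0$ that depends only on the number $|\mathcal S|$ of groups, and an absolute constant $C'>0$ (so that neither depends on $\mathbb P,\hat f,d,n,N,\alpha,p,\xi,\sigma$ or on the splitting rule), such that, with the expectation $\mathbf E$ over $\mathcal D$, $$\mathbf E\bigl[\mathcal U^\alpha(\hat g^\xi_{\alpha,p})\bigr]\le\frac{C}{\sqrt{\min_{s\in\mathcal S}p_s\,N}},\qquad\text{and}\qquad \mathbf E\bigl|\mathbb P_{X|S=s}(\hat g^\xi_{\alpha,p}(X,S)\le\alpha)-p\bigr|\le\frac{C'}{\sqrt{p_sN}}\quad\text{for all } s\in\mathcal S .$$ -/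

import Mathlib

open MeasureTheory ProbabilityTheory

noncomputable section

namespace DPTails

/-- The feature space `ℝ^d`. -/
abbrev Feat (d : ℕ) : Type := EuclideanSpace ℝ (Fin d)

/-! ### The population -/

section Population

variable {d : ℕ} {S : Type*} [MeasurableSpace S]

/-- The group proportion `p_s = ℙ(S = s)` of the joint law `P` of `(X, S, Y)`. -/
def groupProb (P : Measure (Feat d × S × ℝ)) (s : S) : ℝ :=
  P.real {z | z.2.1 = s}

/-- The marginal law of `(X, S)`. -/
def lawXS (P : Measure (Feat d × S × ℝ)) : Measure (Feat d × S) :=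
  P.map (fun z => (z.1, z.2.1))

/-- The conditional law of `X` given `S = s`. -/
def lawXGiven (P : Measure (Feat d × S × ℝ)) (s : S) : Measure (Feat d) :=
  (ProbabilityTheory.cond P {z | z.2.1 = s}).map (fun z => z.1)

/-- The uniform law on `[-σ, σ]`. -/
def jitterLaw (σ : ℝ) : Measure ℝ :=
  ProbabilityTheory.cond volume (Set.Icc (-σ) σ)

/-- The conditional distribution function `t ↦ ℙ(g(X, S, ε) ≤ t | S = s)` of a predictor `g` that
uses, besides the features and the group, a jitter `ε` that is uniform on `[-σ, σ]` and independent
of `(X, S)`. -/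
def predCDF (P : Measure (Feat d × S × ℝ)) (σ : ℝ) (g : Feat d → S → ℝ → ℝ) (s : S) (t : ℝ) : ℝ :=
  ((lawXGiven P s).prod (jitterLaw σ)).real {q | g q.1 s q.2 ≤ t}

/-- The tail-unfairness: the supremum over pairs of groups and over `t ≥ α` of the gap between the
conditional distribution functions. -/
def tailUnfairness (P : Measure (Feat d × S × ℝ)) (σ α : ℝ) (g : Feat d → S → ℝ → ℝ) : ℝ :=
  ⨆ (s : S) (s' : S) (t : Set.Ici α), |predCDF P σ g s t - predCDF P σ g s' t|

end Population

/-! ### The data -/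

section Data

variable {d : ℕ} {S : Type*} {n N : ℕ}

/-- All data: the `n` labeled observations `(X_i, S_i, Y_i)`, the `N` unlabeled observations
`(X_i, S_i)`, and one jitter `ε_i` for each unlabeled observation. -/
abbrev Data (d : ℕ) (S : Type*) (n N : ℕ) : Type _ :=
  (Fin n → Feat d × S × ℝ) × (Fin N → Feat d × S) × (Fin N → ℝ)

/-- The joint law of the data: everything is independent, the labeled observations have law `P`,
the unlabeled ones the law of `(X, S)` under `P`, the jitters are uniform on `[-σ, σ]`. -/
def dataLaw [MeasurableSpace S] (P : Measure (Feat d × S × ℝ)) (σ : ℝ) (n N : ℕ) :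
    Measure (Data d S n N) :=
  (Measure.pi fun _ : Fin n => P).prod
    ((Measure.pi fun _ : Fin N => lawXS P).prod (Measure.pi fun _ : Fin N => jitterLaw σ))

/-- The empirical distribution function of the values `z i`, `i ∈ I` (zero if `I` is empty). -/
def empCDF {ι : Type*} (I : Finset ι) (z : ι → ℝ) (t : ℝ) : ℝ :=
  ((I.filter fun i => z i ≤ t).card : ℝ) / (I.card : ℝ)

/-- The empirical quantile function of the values `z i`, `i ∈ I`. For levels `0 < y ≤ 1` this is
`inf {t | F t ≥ y}`; the clause `0 < F t` only serves to give the smallest observation, and not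
`-∞`, at level `y = 0`. -/
def empQuantile {ι : Type*} (I : Finset ι) (z : ι → ℝ) (y : ℝ) : ℝ :=
  sInf {t | 0 < empCDF I z t ∧ y ≤ empCDF I z t}

variable [DecidableEq S]

/-- The indices of the unlabeled observations that belong to group `s`. -/
def groupIdx (D : Data d S n N) (s : S) : Finset (Fin N) :=
  Finset.univ.filter fun i => (D.2.1 i).2 = s

/-- The position (counted from `0`) of the index `i` within the group `s`. -/
def groupRank (D : Data d S n N) (s : S) (i : Fin N) : ℕ :=
  ((groupIdx D s).filter fun j => j < i).card

/-- A fixed rule that splits, for each group `s` and each group size `m`, the positions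
`{0, …, m - 1}` into two halves (of sizes that differ by one if `m` is odd): `I₀ s m` is the first
half and its complement in `{0, …, m - 1}` the second. -/
def IsHalving (I₀ : S → ℕ → Finset ℕ) : Prop :=
  ∀ s m, I₀ s m ⊆ Finset.range m ∧ m / 2 ≤ (I₀ s m).card ∧ (I₀ s m).card ≤ (m + 1) / 2

/-- The part of group `s` that is used for the distribution function. -/
def half₀ (I₀ : S → ℕ → Finset ℕ) (D : Data d S n N) (s : S) : Finset (Fin N) :=
  (groupIdx D s).filter fun i => groupRank D s i ∈ I₀ s (groupIdx D s).card

/-- The part of group `s` that is used for the quantile function. -/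
def half₁ (I₀ : S → ℕ → Finset ℕ) (D : Data d S n N) (s : S) : Finset (Fin N) :=
  (groupIdx D s).filter fun i => groupRank D s i ∉ I₀ s (groupIdx D s).card

/-- A base estimator: a map from labeled samples to functions of `(x, s)`. -/
abbrev BaseEstimator (d : ℕ) (S : Type*) (n : ℕ) : Type _ :=
  (Fin n → Feat d × S × ℝ) → Feat d → S → ℝ

/-- The jittered scores `f̂(X_i, S_i) + ε_i` of the unlabeled observations. -/
def score (fhat : BaseEstimator d S n) (D : Data d S n N) (i : Fin N) : ℝ :=
  fhat D.1 (D.2.1 i).1 (D.2.1 i).2 + D.2.2 i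

/-- `F̂_{f̂|s}`. -/
def Fhat (I₀ : S → ℕ → Finset ℕ) (fhat : BaseEstimator d S n) (D : Data d S n N) (s : S) (t : ℝ) :
    ℝ :=
  empCDF (half₀ I₀ D s) (score fhat D) t

/-- `Q̂_{f̂|s}`. -/
def Qhat (I₀ : S → ℕ → Finset ℕ) (fhat : BaseEstimator d S n) (D : Data d S n N) (s : S) (y : ℝ) :
    ℝ :=
  empQuantile (half₁ I₀ D s) (score fhat D) y

/-- The estimated group proportion `p̂_s = N_s / N`. -/
def phat (D : Data d S n N) (s : S) : ℝ :=
  ((groupIdx D s).card : ℝ) / (N : ℝ)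

/-- `Q̂^ξ_s`, with threshold `α` and proportion `p`. -/
def Qxi [Fintype S] (I₀ : S → ℕ → Finset ℕ) (fhat : BaseEstimator d S n) (α p ξ : ℝ)
    (D : Data d S n N) (s : S) (y : ℝ) : ℝ :=
  if y ≤ p then min α (Qhat I₀ fhat D s y)
  else max (α + ξ) (∑ s', phat D s' * Qhat I₀ fhat D s' y)

/-- The post-processed estimator `ĝ^ξ_{α,p}`, at the features `x`, the group `s` and the value `e`
of the fresh jitter `ε_s`. -/
def ghat [Fintype S] (I₀ : S → ℕ → Finset ℕ) (fhat : BaseEstimator d S n) (α p ξ : ℝ)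
    (D : Data d S n N) (x : Feat d) (s : S) (e : ℝ) : ℝ :=
  Qxi I₀ fhat α p ξ D s (Fhat I₀ fhat D s (fhat D.1 x s + e))

end Data

end DPTails

end

/-! For `t ≥ α` the lower branch `min α _` of the post-processed quantile function never exceeds
`t`, and the upper branch is the same function for all groups. Hence `ĝ ≤ t` holds exactly when
`F̂_s` of the jittered score falls in a set `J_t` of levels that does not depend on the group and is
an initial segment of `[0, 1]` (`levelSet`, `mem_levelSet_of_le`). The jitter makes the score law of
each group atomless, so its distribution function `F_s` maps the score to a uniform variable. If
`F̂_s` is within `δ_s` of `F_s` everywhere, the conditional probability of `ĝ ≤ t` is within `δ_s`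
of `sup J_t` (`abs_predCDF_ghat_sub_le`). Two groups therefore differ by at most `δ_s + δ_{s'}`,
uniformly in `t`, and `J_α = [0, p]` gives the second claim. This comparison holds for every
realisation of the data, whatever the quantile estimates are.

It remains to bound `E δ_s` by a constant over `√(p_s N)`, without a logarithm, although the sample
behind `F̂_s` is random in size and position (`exists_bound_abs_empCDF_sub_cdf`). Once it is known
which indices belong to the group, the scores there are i.i.d. For a decreasing sequence of sets
`C_k` of conditional probability `r_k`, the process `∑ V_i (1 - 1_{C_k}(ω_i) / r_k)` is a martingale
in `k`: a point of `C_k` survives in `C_{k+1}` with probability `r_{k+1} / r_k`. Doob's `L²`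
inequality controls its maximum by its last second moment, which is bounded as long as `r_k ≥ 1/2`.
Upper rays treat the line up to the median and lower rays treat the rest; a grid of `2N` quantiles
and monotonicity extend the bound to all points. Finally the mean of `1 / (1 + N_s)` is at most `1 /
(p_s N)` (`integral_inv_card_hitSet_le`).

Conditioning is replaced throughout by resampling: redrawing one coordinate independently preserves
the product law (`measurePreserving_update`), so martingale differences appear as orthogonality
relations. -/

noncomputable section

namespace DPTails

/-! ### Resampling one coordinate of a product measure -/

section Resampling

variable {ι Ω : Type*} [DecidableEq ι] [MeasurableSpace Ω]

lemma measurable_update_prod (i : ι) :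
    Measurable fun q : (ι → Ω) × Ω => Function.update q.1 i q.2 := by
  refine measurable_pi_lambda _ fun j => ?_
  by_cases h : j = i
  · subst h
    simpa using measurable_snd
  · simp only [Function.update_of_ne h]
    exact (measurable_pi_apply j).comp measurable_fst

variable [Fintype ι]

/-- The preimage of a box is a box whose `i`-th side is freed and transferred to the extra
coordinate. This is the substitute for conditioning on all coordinates but one. -/
lemma measurePreserving_update (μ : Measure Ω) [IsProbabilityMeasure μ] (i : ι) :
    MeasurePreserving (fun q : (ι → Ω) × Ω => Function.update q.1 i q.2)
      ((Measure.pi fun _ : ι => μ).prod μ) (Measure.pi fun _ : ι => μ) := by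
  refine ⟨measurable_update_prod i, Eq.symm (Measure.pi_eq fun s hs => ?_)⟩
  rw [Measure.map_apply (measurable_update_prod i) (MeasurableSet.univ_pi hs)]
  have h : (fun q : (ι → Ω) × Ω => Function.update q.1 i q.2) ⁻¹' Set.univ.pi s
      = (Set.univ.pi (Function.update s i Set.univ)) ×ˢ s i := by
    ext ⟨ω, x⟩
    simp only [Set.mem_preimage, Set.mem_pi, Set.mem_univ, true_implies, Set.mem_prod]
    constructor
    · intro h
      refine ⟨fun j => ?_, by simpa using h i⟩
      by_cases hj : j = i
      · subst hj; simp
      · simpa [Function.update_of_ne hj] using h j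
    · rintro ⟨h, hx⟩ j
      by_cases hj : j = i
      · subst hj; simpa using hx
      · simpa [Function.update_of_ne hj] using h j
  rw [h, Measure.prod_prod, Measure.pi_pi,
    ← Finset.mul_prod_erase Finset.univ (fun j => μ (s j)) (Finset.mem_univ i),
    ← Finset.mul_prod_erase Finset.univ _ (Finset.mem_univ i), mul_comm]
  simp only [Function.update_self, measure_univ, one_mul]
  congr 1
  refine Finset.prod_congr rfl fun j hj => ?_
  rw [Function.update_of_ne (Finset.ne_of_mem_erase hj)]

/-- If `Y` has mean zero and `G ω` may be computed with the `i`-th coordinate frozen whenever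
`Y (ω i)` does not vanish, then `G` and `Y (ω i)` are orthogonal. -/
lemma integral_mul_eval_eq_zero (μ : Measure Ω) [IsProbabilityMeasure μ] (i : ι) (a : Ω)
    {G : (ι → Ω) → ℝ} {Y : Ω → ℝ} (hG : Measurable G) (hY : Measurable Y)
    (hY0 : ∫ x, Y x ∂μ = 0)
    (h : ∀ ω, G ω * Y (ω i) = G (Function.update ω i a) * Y (ω i)) :
    ∫ ω, G ω * Y (ω i) ∂(Measure.pi fun _ : ι => μ) = 0 := by
  have hm : Measurable fun ω : ι → Ω => G ω * Y (ω i) :=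
    hG.mul (hY.comp (measurable_pi_apply i))
  rw [← (measurePreserving_update μ i).map_eq,
    integral_map (measurable_update_prod i).aemeasurable hm.aestronglyMeasurable]
  -- Freezing the coordinate at `a` removes the fresh draw from `G`, so the integrand is a product
  -- of functions of independent variables.
  have h2 : ∀ q : (ι → Ω) × Ω, G (Function.update q.1 i q.2) * Y (Function.update q.1 i q.2 i)
      = G (Function.update q.1 i a) * Y q.2 := fun q => by
    rw [h, Function.update_idem, Function.update_self]
  simp_rw [h2]
  rw [integral_prod_mul (fun ω => G (Function.update ω i a)) Y, hY0, mul_zero]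

end Resampling

/-! ### A discrete form of Doob's maximal inequality -/

section Doob

/-- The running maximum `max 0 (max_{j ≤ k} W j)`. -/
def runMax (W : ℕ → ℝ) : ℕ → ℝ
  | 0 => max 0 (W 0)
  | k + 1 => max (runMax W k) (W (k + 1))

lemma runMax_nonneg (W : ℕ → ℝ) (k : ℕ) : 0 ≤ runMax W k := by
  induction k with
  | zero => exact le_max_left _ _
  | succ k ih => exact ih.trans (le_max_left _ _)

lemma le_runMax (W : ℕ → ℝ) {j k : ℕ} (h : j ≤ k) : W j ≤ runMax W k := by
  induction k with
  | zero =>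
    obtain rfl : j = 0 := by omega
    exact le_max_right _ _
  | succ k ih =>
    rcases Nat.lt_or_ge j (k + 1) with h1 | h1
    · exact (ih (by omega)).trans (le_max_left _ _)
    · obtain rfl : j = k + 1 := by omega
      exact le_max_right _ _

lemma runMax_le {W : ℕ → ℝ} {b : ℝ} (hb : 0 ≤ b) (h : ∀ k, W k ≤ b) (k : ℕ) :
    runMax W k ≤ b := by
  induction k with
  | zero => exact max_le hb (h 0)
  | succ k ih => exact max_le ih (h _)

lemma runMax_congr {W W' : ℕ → ℝ} {k : ℕ} (h : ∀ j ≤ k, W j = W' j) :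
    runMax W k = runMax W' k := by
  induction k with
  | zero => simp [runMax, h 0 le_rfl]
  | succ k ih => simp [runMax, h (k + 1) le_rfl, ih fun j hj => h j (by omega)]

lemma measurable_runMax {E : Type*} [MeasurableSpace E] {W : ℕ → E → ℝ}
    (hW : ∀ k, Measurable (W k)) (k : ℕ) : Measurable fun ω => runMax (fun j => W j ω) k := by
  induction k with
  | zero => exact measurable_const.max (hW 0)
  | succ k ih => exact ih.max (hW _)

/-- The functional `2MW - M²` grows by at least `2M(w' - w)` in one step: there is equality if the
maximum does not move, and otherwise the gap is `(M - w')²`. Under orthogonality its mean is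
therefore nondecreasing. -/
lemma runMax_sq_step (M w w' : ℝ) :
    2 * M * w - M ^ 2 + 2 * (M * (w' - w)) ≤ 2 * max M w' * w' - max M w' ^ 2 := by
  rcases le_total M w' with h | h
  · rw [max_eq_right h]; nlinarith [sq_nonneg (M - w')]
  · rw [max_eq_left h]; nlinarith

variable {E : Type*} [MeasurableSpace E]

/-- The pathwise proof of Doob's inequality: it only needs each increment to be orthogonal to the
current running maximum, and no filtration. It combines `0 ≤ E(2MW - M²)` with `4MW - M² ≤ 4W²`. -/
lemma integral_runMax_sq_le (π : Measure E) [IsProbabilityMeasure π] {W : ℕ → E → ℝ} {b : ℝ}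
    (hW : ∀ k, Measurable (W k)) (hb : ∀ k ω, |W k ω| ≤ b)
    (horth : ∀ k, ∫ ω, runMax (fun j => W j ω) k * (W (k + 1) ω - W k ω) ∂π = 0) (k : ℕ) :
    ∫ ω, runMax (fun j => W j ω) k ^ 2 ∂π ≤ 4 * ∫ ω, W k ω ^ 2 ∂π := by
  have hb0 : 0 ≤ b := by
    obtain ⟨ω⟩ : Nonempty E := nonempty_of_isProbabilityMeasure π
    exact (abs_nonneg _).trans (hb 0 ω)
  have hM := measurable_runMax hW
  have hMb : ∀ k ω, |runMax (fun j => W j ω) k| ≤ b := fun k ω => by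
    rw [abs_of_nonneg (runMax_nonneg _ _)]
    exact runMax_le hb0 (fun j => (le_abs_self _).trans (hb j ω)) k
  have int : ∀ (f g : E → ℝ) (c c' : ℝ), Measurable f → Measurable g → (∀ ω, |f ω| ≤ c) →
      (∀ ω, |g ω| ≤ c') → Integrable (fun ω => f ω * g ω) π := fun f g c c' hf hg hc hc' =>
    Integrable.of_bound (hf.mul hg).aestronglyMeasurable (c * c')
      (ae_of_all _ fun ω => by
        rw [Real.norm_eq_abs, abs_mul]
        exact mul_le_mul (hc ω) (hc' ω) (abs_nonneg _) ((abs_nonneg _).trans (hc ω)))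
  have iMW : ∀ k l, Integrable (fun ω => runMax (fun j => W j ω) k * W l ω) π :=
    fun k l => int _ _ _ _ (hM k) (hW l) (hMb k) (hb l)
  have iMM : ∀ k, Integrable (fun ω => runMax (fun j => W j ω) k ^ 2) π := fun k => by
    simpa only [sq] using int _ _ _ _ (hM k) (hM k) (hMb k) (hMb k)
  have iWW : ∀ k, Integrable (fun ω => W k ω ^ 2) π := fun k => by
    simpa only [sq] using int _ _ _ _ (hW k) (hW k) (hb k) (hb k)
  have iD : ∀ k, Integrable (fun ω => 2 * (runMax (fun j => W j ω) k * W k ω)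
      - runMax (fun j => W j ω) k ^ 2) π := fun k => ((iMW k k).const_mul 2).sub (iMM k)
  have key : ∀ k, 0 ≤ ∫ ω, (2 * (runMax (fun j => W j ω) k * W k ω)
      - runMax (fun j => W j ω) k ^ 2) ∂π := by
    intro k
    induction k with
    | zero =>
      refine integral_nonneg fun ω => ?_
      simp only [runMax, Pi.zero_apply]
      rcases le_total 0 (W 0 ω) with h | h
      · rw [max_eq_right h]; nlinarith
      · rw [max_eq_left h]; simp
    | succ k ih =>
      have i2 : Integrable (fun ω => 2 * (runMax (fun j => W j ω) k * W (k + 1) ω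
          - runMax (fun j => W j ω) k * W k ω)) π := ((iMW k (k + 1)).sub (iMW k k)).const_mul 2
      have e : ∫ ω, ((2 * (runMax (fun j => W j ω) k * W k ω) - runMax (fun j => W j ω) k ^ 2)
          + 2 * (runMax (fun j => W j ω) k * W (k + 1) ω
            - runMax (fun j => W j ω) k * W k ω)) ∂π
          = ∫ ω, (2 * (runMax (fun j => W j ω) k * W k ω)
            - runMax (fun j => W j ω) k ^ 2) ∂π := by
        rw [integral_add (iD k) i2, integral_const_mul]
        have := horth k
        simp only [mul_sub] at this
        rw [this, mul_zero, add_zero]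
      rw [← e] at ih
      refine ih.trans (integral_mono ((iD k).add i2) (iD (k + 1)) fun ω => ?_)
      have := runMax_sq_step (runMax (fun j => W j ω) k) (W k ω) (W (k + 1) ω)
      simp only [runMax]
      linarith
  have h1 : ∫ ω, (runMax (fun j => W j ω) k ^ 2
      + 2 * (2 * (runMax (fun j => W j ω) k * W k ω) - runMax (fun j => W j ω) k ^ 2)) ∂π
      ≤ ∫ ω, 4 * W k ω ^ 2 ∂π := by
    refine integral_mono ((iMM k).add ((iD k).const_mul 2))
      ((iWW k).const_mul 4) fun ω => ?_
    have := sq_nonneg (2 * W k ω - runMax (fun j => W j ω) k)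
    simp only
    linarith
  rw [integral_add (iMM k) ((iD k).const_mul 2),
    integral_const_mul, integral_const_mul] at h1
  linarith [key k]

end Doob

/-! ### Weighted empirical processes on a random subsample -/

section Weighted

lemma integrable_of_abs_le {E : Type*} [MeasurableSpace E] (π : Measure E)
    [IsFiniteMeasure π] {f : E → ℝ} {c : ℝ} (hf : Measurable f) (hc : ∀ ω, |f ω| ≤ c) :
    Integrable f π :=
  Integrable.of_bound hf.aestronglyMeasurable c (ae_of_all _ fun ω => by simpa using hc ω)

variable {Ω : Type*}

/-- The values are `1` and `1 - 1/r`, and the latter lies in `[-1, 1]` precisely because `r` is not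
below one half. -/
lemma abs_one_sub_indicator_div_le (C : Set Ω) {r : ℝ} (hr : 1 / 2 ≤ r) (x : Ω) :
    |1 - C.indicator 1 x / r| ≤ 1 := by
  have h0 : 0 < r := by linarith
  have h2 : 1 / r ≤ 2 := by rw [div_le_iff₀ h0]; linarith
  have h3 : 0 < 1 / r := by positivity
  by_cases h : x ∈ C
  · simp only [Set.indicator_of_mem h, Pi.one_apply]
    rw [abs_le]; constructor <;> linarith
  · simp [Set.indicator_of_notMem h]

lemma integral_indicator_mul_indicator_div [MeasurableSpace Ω] (μ : Measure Ω)
    [IsProbabilityMeasure μ] {A C : Set Ω} (hA : MeasurableSet A) (hC : MeasurableSet C) {r : ℝ}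
    (hr : 0 < r)
    (h : μ.real (A ∩ C) = r * μ.real A) :
    Integrable (fun x => A.indicator (1 : Ω → ℝ) x * (C.indicator 1 x / r)) μ ∧
      ∫ x, A.indicator (1 : Ω → ℝ) x * (C.indicator 1 x / r) ∂μ = μ.real A := by
  have e : (fun x => A.indicator (1 : Ω → ℝ) x * (C.indicator 1 x / r))
      = fun x => (A ∩ C).indicator (1 : Ω → ℝ) x / r := by
    ext x
    by_cases h1 : x ∈ A <;> by_cases h2 : x ∈ C <;> simp [h1, h2]
  rw [e]
  refine ⟨Integrable.div_const ((integrable_const (1 : ℝ)).indicator (hA.inter hC)) r, ?_⟩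
  rw [integral_div, integral_indicator_one (hA.inter hC), h, mul_div_cancel_left₀ _ hr.ne']

variable {ι : Type*} [Fintype ι]

open Classical in
/-- The set of indices `i` with `ω i ∈ A`. -/
def hitSet (A : Set Ω) (ω : ι → Ω) : Finset ι :=
  Finset.univ.filter fun i => ω i ∈ A

@[simp] lemma mem_hitSet {A : Set Ω} {ω : ι → Ω} {i : ι} : i ∈ hitSet A ω ↔ ω i ∈ A := by
  simp [hitSet]

/-- Moving a point inside `A` leaves the weights unchanged; this is why weights depending on the
random index set do not destroy orthogonality. -/
lemma hitSet_update [DecidableEq ι] {A : Set Ω} {ω : ι → Ω} {i : ι} {a : Ω} (h : ω i ∈ A)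
    (ha : a ∈ A) : hitSet A (Function.update ω i a) = hitSet A ω := by
  ext j
  by_cases hj : j = i
  · subst hj; simp [h, ha]
  · simp [Function.update_of_ne hj]

/-- The weighted process `∑ V i (1 - 1_C (ω i) / r)`, where the weights depend on the set of
indices that hit `A`. -/
def wProc (A C : Set Ω) (r : ℝ) (V : ι → Finset ι → ℝ) (ω : ι → Ω) : ℝ :=
  ∑ i, V i (hitSet A ω) * (1 - C.indicator 1 (ω i) / r)

lemma wProc_neg (A C : Set Ω) (r : ℝ) (V : ι → Finset ι → ℝ) (ω : ι → Ω) :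
    wProc A C r (fun i B => - V i B) ω = - wProc A C r V ω := by
  simp [wProc]

lemma abs_le_one_of_sum_sq_le_one {v : ι → ℝ} (hv : ∑ i, v i ^ 2 ≤ 1) (i : ι) : |v i| ≤ 1 := by
  rw [← sq_le_one_iff_abs_le_one]
  exact (Finset.single_le_sum (f := fun i => v i ^ 2) (fun _ _ => sq_nonneg _)
    (Finset.mem_univ i)).trans hv

lemma abs_wProc_le (A C : Set Ω) {r : ℝ} (hr : 1 / 2 ≤ r) {V : ι → Finset ι → ℝ}
    (hV : ∀ B, ∑ i, V i B ^ 2 ≤ 1) (ω : ι → Ω) : |wProc A C r V ω| ≤ Fintype.card ι := by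
  have hV1 : ∀ i B, |V i B| ≤ 1 := fun i B => abs_le_one_of_sum_sq_le_one (hV B) i
  refine (Finset.abs_sum_le_sum_abs _ _).trans ?_
  refine (Finset.sum_le_card_nsmul _ _ 1 fun i _ => ?_).trans (by simp [Finset.card_univ])
  rw [abs_mul]
  exact mul_le_one₀ (hV1 _ _) (abs_nonneg _) (abs_one_sub_indicator_div_le C hr _)

variable [MeasurableSpace Ω]

lemma measurable_hitSet_comp {β : Type*} [MeasurableSpace β] {A : Set Ω} (hA : MeasurableSet A)
    (φ : Finset ι → β) : Measurable fun ω : ι → Ω => φ (hitSet A ω) := by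
  classical
  let _ : MeasurableSpace (Finset ι) := ⊤
  have h : Measurable fun ω : ι → Ω => hitSet A ω := by
    refine measurable_to_countable' fun B => ?_
    have : (fun ω : ι → Ω => hitSet A ω) ⁻¹' {B}
        = ⋂ i, {ω | ω i ∈ A ↔ i ∈ B} := by
      ext ω
      simp [Finset.ext_iff]
    rw [this]
    refine MeasurableSet.iInter fun i => ?_
    have hm : MeasurableSet {ω : ι → Ω | ω i ∈ A} := measurable_pi_apply i hA
    by_cases hi : i ∈ B
    · simpa [hi] using hm
    · simp only [hi, iff_false]
      exact hm.compl
  exact (measurable_from_top (f := φ)).comp h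

lemma measurable_indicator_one_comp {C : Set Ω} (hC : MeasurableSet C) (r : ℝ) :
    Measurable fun x : Ω => C.indicator (1 : Ω → ℝ) x / r :=
  (measurable_one.indicator hC).div_const r

lemma measurable_wProc {A C : Set Ω} (hA : MeasurableSet A) (hC : MeasurableSet C) (r : ℝ)
    (V : ι → Finset ι → ℝ) : Measurable (wProc A C r V) :=
  Finset.measurable_sum _ fun i _ => (measurable_hitSet_comp hA (V i)).mul
    (measurable_const.sub ((measurable_indicator_one_comp hC r).comp (measurable_pi_apply i)))

variable [DecidableEq ι]

/-- Given the hit set, the summands are centred and independent, so cross terms vanish; on the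
diagonal each factor is at most `1` and the squared weights sum to at most `1`. -/
lemma integral_wProc_sq_le (μ : Measure Ω) [IsProbabilityMeasure μ] {A C : Set Ω}
    (hA : MeasurableSet A) (hC : MeasurableSet C) (hA0 : 0 < μ.real A) {r : ℝ} (hr : 1 / 2 ≤ r)
    (h : μ.real (A ∩ C) = r * μ.real A) {V : ι → Finset ι → ℝ}
    (hV0 : ∀ i B, i ∉ B → V i B = 0) (hV : ∀ B, ∑ i, V i B ^ 2 ≤ 1) :
    ∫ ω, wProc A C r V ω ^ 2 ∂(Measure.pi fun _ : ι => μ) ≤ 1 := by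
  set π := Measure.pi fun _ : ι => μ
  have hr0 : 0 < r := by linarith
  have hV1 : ∀ i B, |V i B| ≤ 1 := fun i B => abs_le_one_of_sum_sq_le_one (hV B) i
  obtain ⟨a, ha⟩ : A.Nonempty := by
    by_contra hne
    rw [Set.not_nonempty_iff_eq_empty] at hne
    simp [hne] at hA0
  let η : Ω → ℝ := fun x => 1 - C.indicator 1 x / r
  have hη : Measurable η := measurable_const.sub (measurable_indicator_one_comp hC r)
  have hη1 : ∀ x, |η x| ≤ 1 := abs_one_sub_indicator_div_le C hr
  have hVm : ∀ i, Measurable fun ω : ι → Ω => V i (hitSet A ω) :=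
    fun i => measurable_hitSet_comp hA (V i)
  have hT1 : ∀ i (ω : ι → Ω), |V i (hitSet A ω) * η (ω i)| ≤ 1 := fun i ω => by
    rw [abs_mul]; exact mul_le_one₀ (hV1 _ _) (abs_nonneg _) (hη1 _)
  have hTm : ∀ i, Measurable fun ω : ι → Ω => V i (hitSet A ω) * η (ω i) := fun i =>
    (hVm i).mul (hη.comp (measurable_pi_apply i))
  have hTi : ∀ i j, Integrable (fun ω : ι → Ω =>
      (V i (hitSet A ω) * η (ω i)) * (V j (hitSet A ω) * η (ω j))) π := fun i j =>
    integrable_of_abs_le π (c := 1) ((hTm i).mul (hTm j)) fun ω => by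
      rw [abs_mul]; exact mul_le_one₀ (hT1 i ω) (abs_nonneg _) (hT1 j ω)
  have hV2 : ∀ i, Integrable (fun ω : ι → Ω => V i (hitSet A ω) ^ 2) π := fun i =>
    integrable_of_abs_le π (c := 1) ((hVm i).pow_const 2) fun ω => by
      rw [abs_pow]; exact pow_le_one₀ (abs_nonneg _) (hV1 _ _)
  have hoff : ∀ i j, i ≠ j → ∫ ω, (V i (hitSet A ω) * η (ω i)) *
      (V j (hitSet A ω) * η (ω j)) ∂π = 0 := by
    intro i j hij
    obtain ⟨i1, e1⟩ := integral_indicator_mul_indicator_div μ hA hC hr0 h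
    -- The factor `1_A` may be inserted because the weights vanish off the hit set; it makes the
    -- resampled factor centred.
    have hY0 : ∫ x, A.indicator (1 : Ω → ℝ) x * η x ∂μ = 0 := by
      simp only [η, mul_sub, mul_one]
      have i0 : Integrable (A.indicator (1 : Ω → ℝ)) μ := (integrable_const (1 : ℝ)).indicator hA
      rw [integral_sub i0 i1, e1,
        integral_indicator_one hA, sub_self]
    have := integral_mul_eval_eq_zero μ i a
      (G := fun ω => V i (hitSet A ω) * (V j (hitSet A ω) * η (ω j)))
      (Y := fun x => A.indicator (1 : Ω → ℝ) x * η x)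
      ((hVm i).mul (hTm j)) ((measurable_one.indicator hA).mul hη) hY0 (fun ω => by
        by_cases hi : ω i ∈ A
        · simp only [hitSet_update hi ha, Function.update_of_ne hij.symm]
        · simp [Set.indicator_of_notMem hi])
    rw [← this]
    congr 1
    ext ω
    by_cases hi : ω i ∈ A
    · simp only [Set.indicator_of_mem hi, Pi.one_apply]; ring
    · simp [hV0 i (hitSet A ω) (by simpa using hi)]
  calc ∫ ω, wProc A C r V ω ^ 2 ∂π
      = ∫ ω, ∑ i, ∑ j, (V i (hitSet A ω) * η (ω i)) * (V j (hitSet A ω) * η (ω j)) ∂π := by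
        simp only [wProc, sq, Finset.sum_mul_sum, η]
    _ = ∑ i, ∑ j, ∫ ω, (V i (hitSet A ω) * η (ω i)) * (V j (hitSet A ω) * η (ω j)) ∂π := by
        rw [integral_finsetSum _ fun i _ => integrable_finsetSum _ fun j _ => hTi i j]
        exact Finset.sum_congr rfl fun i _ => integral_finsetSum _ fun j _ => hTi i j
    _ = ∑ i, ∫ ω, (V i (hitSet A ω) * η (ω i)) * (V i (hitSet A ω) * η (ω i)) ∂π :=
        Finset.sum_congr rfl fun i _ =>
          Finset.sum_eq_single i (fun j _ hj => hoff i j hj.symm) (by simp)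
    _ ≤ ∑ i, ∫ ω, V i (hitSet A ω) ^ 2 ∂π := by
        refine Finset.sum_le_sum fun i _ => integral_mono (hTi i i) (hV2 i) fun ω => ?_
        have h1 : η (ω i) ^ 2 ≤ 1 := (sq_le_one_iff_abs_le_one _).2 (hη1 _)
        have h2 := sq_nonneg (V i (hitSet A ω))
        simp only
        nlinarith
    _ = ∫ ω, ∑ i, V i (hitSet A ω) ^ 2 ∂π := (integral_finsetSum _ fun i _ => hV2 i).symm
    _ ≤ ∫ _, 1 ∂π :=
        integral_mono (integrable_finsetSum _ fun i _ => hV2 i) (integrable_const 1)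
          fun ω => hV _
    _ = 1 := by simp

/-- Doob's factor `4` times the second moment bound `1`, once the increments are shown orthogonal to
the running maximum, coordinate by coordinate. -/
lemma integral_runMax_wProc_sq_le (μ : Measure Ω) [IsProbabilityMeasure μ] {A : Set Ω}
    {C : ℕ → Set Ω} (hA : MeasurableSet A) (hC : ∀ k, MeasurableSet (C k)) (hCa : Antitone C)
    (hA0 : 0 < μ.real A) {r : ℕ → ℝ} (hr : ∀ k, 1 / 2 ≤ r k)
    (h : ∀ k, μ.real (A ∩ C k) = r k * μ.real A) {V : ι → Finset ι → ℝ}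
    (hV0 : ∀ i B, i ∉ B → V i B = 0) (hV : ∀ B, ∑ i, V i B ^ 2 ≤ 1) (K : ℕ) :
    ∫ ω, runMax (fun k => wProc A (C k) (r k) V ω) K ^ 2 ∂(Measure.pi fun _ : ι => μ) ≤ 4 := by
  have hr0 : ∀ k, 0 < r k := fun k => by linarith [hr k]
  have hWm : ∀ k, Measurable (wProc A (C k) (r k) V) := fun k => measurable_wProc hA (hC k) _ V
  have hM := measurable_runMax hWm
  have hVm : ∀ i, Measurable fun ω : ι → Ω => V i (hitSet A ω) :=
    fun i => measurable_hitSet_comp hA (V i)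
  have hWb : ∀ k (ω : ι → Ω), |wProc A (C k) (r k) V ω| ≤ Fintype.card ι :=
    fun k => abs_wProc_le A (C k) (hr k) hV
  have hV1 : ∀ i B, |V i B| ≤ 1 := fun i B => abs_le_one_of_sum_sq_le_one (hV B) i
  refine (integral_runMax_sq_le _ hWm hWb (fun k => ?_) K).trans ?_
  · let Y : Ω → ℝ := fun x => A.indicator 1 x *
      ((C k).indicator 1 x / r k - (C (k + 1)).indicator 1 x / r (k + 1))
    have hYm : Measurable Y := (measurable_one.indicator hA).mul
      ((measurable_indicator_one_comp (hC k) _).sub (measurable_indicator_one_comp (hC (k + 1)) _))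
    have hYb : ∀ x, |Y x| ≤ 2 := fun x => by
      have h1 := abs_one_sub_indicator_div_le (C k) (hr k) x
      have h2 := abs_one_sub_indicator_div_le (C (k + 1)) (hr (k + 1)) x
      have h3 : |A.indicator (1 : Ω → ℝ) x| ≤ 1 := by
        by_cases hx : x ∈ A <;> simp [hx]
      rw [abs_le] at h1 h2
      have h4 : |(C k).indicator 1 x / r k - (C (k + 1)).indicator 1 x / r (k + 1)| ≤ 2 := by
        rw [abs_le]; constructor <;> linarith
      simp only [Y, abs_mul]
      nlinarith [abs_nonneg (A.indicator (1 : Ω → ℝ) x)]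
    have hY0 : ∫ x, Y x ∂μ = 0 := by
      obtain ⟨i1, e1⟩ := integral_indicator_mul_indicator_div μ hA (hC k) (hr0 k) (h k)
      obtain ⟨i2, e2⟩ :=
        integral_indicator_mul_indicator_div μ hA (hC (k + 1)) (hr0 (k + 1)) (h (k + 1))
      simp only [Y, mul_sub]
      rw [integral_sub i1 i2, e1, e2, sub_self]
    obtain ⟨a, ha, hak⟩ : (A ∩ C k).Nonempty := by
      by_contra hne
      rw [Set.not_nonempty_iff_eq_empty] at hne
      have := h k
      rw [hne, measureReal_empty] at this
      have := mul_pos (hr0 k) hA0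
      linarith
    have e : ∀ ω : ι → Ω, runMax (fun j => wProc A (C j) (r j) V ω) k *
        (wProc A (C (k + 1)) (r (k + 1)) V ω - wProc A (C k) (r k) V ω) =
        ∑ i, (runMax (fun j => wProc A (C j) (r j) V ω) k * V i (hitSet A ω)) * Y (ω i) := by
      intro ω
      rw [wProc, wProc, ← Finset.sum_sub_distrib, Finset.mul_sum]
      refine Finset.sum_congr rfl fun i _ => ?_
      by_cases hi : ω i ∈ A
      · simp only [Y, Set.indicator_of_mem hi, Pi.one_apply]; ring
      · simp [hV0 i (hitSet A ω) (by simpa using hi)]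
    simp_rw [e]
    rw [integral_finsetSum]
    · refine Finset.sum_eq_zero fun i _ => ?_
      refine integral_mul_eval_eq_zero μ i a ((hM k).mul (hVm i)) hYm hY0 fun ω => ?_
      -- If `ω i` lies in `A ∩ C k`, nestedness puts both `ω i` and `a` in every earlier `C j`, so
      -- the maximum up to `k` does not notice the replacement. Otherwise the increment `Y` vanishes
      -- at `ω i`.
      by_cases hi : ω i ∈ A ∧ ω i ∈ C k
      · have hh : hitSet A (Function.update ω i a) = hitSet A ω := hitSet_update hi.1 ha
        have : runMax (fun j => wProc A (C j) (r j) V (Function.update ω i a)) k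
            = runMax (fun j => wProc A (C j) (r j) V ω) k := by
          refine runMax_congr fun j hj => ?_
          simp only [wProc, hh]
          refine Finset.sum_congr rfl fun l _ => ?_
          by_cases hl : l = i
          · subst hl
            rw [Function.update_self, Set.indicator_of_mem (hCa hj hak),
              Set.indicator_of_mem (hCa hj hi.2)]
            rfl
          · rw [Function.update_of_ne hl]
        simp only [hh, this]
      · have : Y (ω i) = 0 := by
          by_cases h1 : ω i ∈ A
          · have h2 : ω i ∉ C k := fun h2 => hi ⟨h1, h2⟩
            have h3 : ω i ∉ C (k + 1) := fun h3 => h2 (hCa (Nat.le_succ k) h3)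
            simp [Y, h2, h3]
          · simp [Y, h1]
        simp [this]
    · intro i _
      refine integrable_of_abs_le _ (c := Fintype.card ι * 1 * 2)
        (((hM k).mul (hVm i)).mul (hYm.comp (measurable_pi_apply i))) fun ω => ?_
      rw [abs_mul, abs_mul]
      have : |runMax (fun j => wProc A (C j) (r j) V ω) k| ≤ Fintype.card ι := by
        rw [abs_of_nonneg (runMax_nonneg _ _)]
        exact runMax_le (by positivity) (fun j => (le_abs_self _).trans (hWb j ω)) k
      gcongr
      · exact hV1 _ _
      · exact hYb _
  · linarith [integral_wProc_sq_le μ hA (hC K) hA0 (hr K) (h K) hV0 hV]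

/-- The mean of the reciprocal of one plus the number of hits. -/
lemma integral_inv_card_hitSet_le (μ : Measure Ω) [IsProbabilityMeasure μ] {A : Set Ω}
    (hA : MeasurableSet A) (hA0 : 0 < μ.real A) [Nonempty ι] :
    ∫ ω : ι → Ω, (((hitSet A ω).card : ℝ) + 1)⁻¹ ∂(Measure.pi fun _ : ι => μ)
      ≤ (Fintype.card ι * μ.real A)⁻¹ := by
  set π := Measure.pi fun _ : ι => μ
  let f : (ι → Ω) → ℝ := fun ω => (((hitSet A ω).card : ℝ) + 1)⁻¹
  have hf0 : ∀ ω, 0 < f ω := fun ω => by positivity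
  have hf1 : ∀ ω, f ω ≤ 1 := fun ω => inv_le_one_of_one_le₀ (by simp)
  have hfm : Measurable f := measurable_hitSet_comp hA fun B => ((B.card : ℝ) + 1)⁻¹
  have hfi : Integrable f π := integrable_of_abs_le π (c := 1) hfm fun ω => by
    rw [abs_of_pos (hf0 ω)]; exact hf1 ω
  -- Size biasing: these terms sum to at most `1` over `i`.
  let g : ι → (ι → Ω) → ℝ := fun i ω => if i ∈ hitSet A ω then ((hitSet A ω).card : ℝ)⁻¹ else 0
  have hgm : ∀ i, Measurable (g i) := fun i =>
    measurable_hitSet_comp hA fun B => if i ∈ B then (B.card : ℝ)⁻¹ else 0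
  have hgb : ∀ i ω, |g i ω| ≤ 1 := fun i ω => by
    simp only [g]
    split_ifs with h
    · have : 1 ≤ (hitSet A ω).card := Finset.card_pos.2 ⟨i, h⟩
      rw [abs_of_nonneg (by positivity)]
      exact inv_le_one_of_one_le₀ (by exact_mod_cast this)
    · simp
  have hgi : ∀ i, Integrable (g i) π := fun i => integrable_of_abs_le π (hgm i) (hgb i)
  have hsum : ∑ i, ∫ ω, g i ω ∂π ≤ 1 := by
    rw [← integral_finsetSum _ fun i _ => hgi i]
    calc ∫ ω, ∑ i, g i ω ∂π ≤ ∫ _, 1 ∂π := by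
          refine integral_mono (integrable_finsetSum _ fun i _ => hgi i) (integrable_const 1)
            fun ω => ?_
          simp only [g, Finset.sum_ite_mem, Finset.univ_inter, Finset.sum_const, nsmul_eq_mul]
          exact mul_inv_le_one
      _ = 1 := by simp
  -- With probability `μ(A)` the redrawn coordinate hits `A`, and then the number of hits is at most
  -- one more than before the redraw.
  have hterm : ∀ i, μ.real A * ∫ ω, f ω ∂π ≤ ∫ ω, g i ω ∂π := by
    intro i
    have e1 : ∫ ω, g i ω ∂π = ∫ q : (ι → Ω) × Ω, g i (Function.update q.1 i q.2) ∂(π.prod μ) := by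
      rw [← integral_map (measurable_update_prod i).aemeasurable (hgm i).aestronglyMeasurable,
        (measurePreserving_update μ i).map_eq]
    have e2 : μ.real A * ∫ ω, f ω ∂π
        = ∫ q : (ι → Ω) × Ω, f q.1 * A.indicator (1 : Ω → ℝ) q.2 ∂(π.prod μ) := by
      rw [integral_prod_mul, integral_indicator_one hA, mul_comm]
    rw [e1, e2]
    refine integral_mono (hfi.mul_prod ((integrable_const (1 : ℝ)).indicator hA)) ?_ fun q => ?_
    · exact integrable_of_abs_le _ ((hgm i).comp (measurable_update_prod i)) fun q => hgb i _
    · by_cases hq : q.2 ∈ A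
      · have hi : i ∈ hitSet A (Function.update q.1 i q.2) := by simp [hq]
        have hc : (hitSet A (Function.update q.1 i q.2)).card ≤ (hitSet A q.1).card + 1 := by
          refine (Finset.card_le_card (t := insert i (hitSet A q.1)) fun j hj => ?_).trans
            (Finset.card_insert_le _ _)
          by_cases hji : j = i
          · simp [hji]
          · simpa [hji, Function.update_of_ne hji] using hj
        have hc0 : 0 < (hitSet A (Function.update q.1 i q.2)).card := Finset.card_pos.2 ⟨i, hi⟩
        simp only [g, f, if_pos hi, Set.indicator_of_mem hq, Pi.one_apply, mul_one]
        refine inv_anti₀ (by exact_mod_cast hc0) (by exact_mod_cast hc)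
      · simp only [Set.indicator_of_notMem hq, mul_zero, g]
        split_ifs <;> positivity
  have := (Finset.sum_le_sum fun i (_ : i ∈ Finset.univ) => hterm i).trans hsum
  rw [Finset.sum_const, Finset.card_univ, nsmul_eq_mul, ← mul_assoc] at this
  rw [inv_eq_one_div, le_div_iff₀ (mul_pos (by exact_mod_cast Fintype.card_pos) hA0), mul_comm]
  exact this

end Weighted

/-! ### Distribution functions of atomless laws -/

section RealLine

variable (ρ : Measure ℝ)

lemma continuous_cdf [IsProbabilityMeasure ρ] [NullSingletonClass ρ] : Continuous (cdf ρ) := by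
  rw [continuous_iff_continuousAt]
  intro x
  rw [(monotone_cdf ρ).continuousAt_iff_leftLim_eq_rightLim, StieltjesFunction.rightLim_eq]
  have h := (cdf ρ).measure_singleton x
  rw [measure_cdf, measure_singleton, eq_comm, ENNReal.ofReal_eq_zero] at h
  exact le_antisymm ((monotone_cdf ρ).leftLim_le le_rfl) (by linarith)

lemma exists_cdf_eq [IsProbabilityMeasure ρ] [NullSingletonClass ρ] {v : ℝ} (h0 : 0 < v)
    (h1 : v < 1) : ∃ x, cdf ρ x = v := by
  refine mem_range_of_exists_le_of_exists_ge (continuous_cdf ρ) ?_ ?_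
  · exact ((tendsto_cdf_atBot ρ).eventually_le_const h0).exists
  · exact ((tendsto_cdf_atTop ρ).eventually_const_le h1).exists

/-- Half of the probability integral transform. Approaching `v` through levels `w > v` that are
attained avoids a discussion of flat pieces and of the end levels. -/
lemma measureReal_cdf_le_le [IsProbabilityMeasure ρ] [NullSingletonClass ρ] {v : ℝ} (hv : 0 ≤ v) :
    ρ.real {x | cdf ρ x ≤ v} ≤ v := by
  refine le_of_forall_gt_imp_ge_of_dense fun w hw => ?_
  rcases le_or_gt 1 w with h1 | h1
  · exact measureReal_le_one.trans h1
  · obtain ⟨c, hc⟩ := exists_cdf_eq ρ (hv.trans_lt hw) h1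
    rw [← hc, cdf_eq_real]
    refine measureReal_mono fun x (hx : cdf ρ x ≤ v) => ?_
    by_contra hcx
    have := monotone_cdf ρ (not_le.1 hcx).le
    linarith

lemma le_measureReal_cdf_lt [IsProbabilityMeasure ρ] [NullSingletonClass ρ] {v : ℝ} (hv : v ≤ 1) :
    v ≤ ρ.real {x | cdf ρ x < v} := by
  refine le_of_forall_lt_imp_le_of_dense fun w hw => ?_
  rcases le_or_gt w 0 with h0 | h0
  · exact h0.trans measureReal_nonneg
  · obtain ⟨c, hc⟩ := exists_cdf_eq ρ h0 (hw.trans_le hv)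
    rw [← hc, cdf_eq_real]
    exact measureReal_mono fun x hx => ((monotone_cdf ρ hx).trans_eq hc).trans_lt hw

/-- If `f` is uniformly close to the distribution function, the law of `f` is close to the uniform
law on initial segments of `[0, 1]`. -/
lemma abs_measureReal_preimage_sub_sSup_le [IsProbabilityMeasure ρ] [NullSingletonClass ρ]
    {J : Set ℝ} (hJ : J ⊆ Set.Icc 0 1) (hJ0 : (0 : ℝ) ∈ J)
    (hJl : ∀ y ∈ J, ∀ y', 0 ≤ y' → y' ≤ y → y' ∈ J) {f : ℝ → ℝ} (hf : ∀ x, 0 ≤ f x) {δ : ℝ}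
    (h : ∀ x, |f x - cdf ρ x| ≤ δ) : |ρ.real {x | f x ∈ J} - sSup J| ≤ δ := by
  have hδ : 0 ≤ δ := (abs_nonneg _).trans (h 0)
  have hb : BddAbove J := ⟨1, fun y hy => (hJ hy).2⟩
  have hu0 : 0 ≤ sSup J := le_csSup hb hJ0
  have hu1 : sSup J ≤ 1 := csSup_le ⟨0, hJ0⟩ fun y hy => (hJ hy).2
  rw [abs_le]
  constructor
  · have h1 := le_measureReal_cdf_lt ρ (v := sSup J - δ) (by linarith)
    have h2 : ρ.real {x | cdf ρ x < sSup J - δ} ≤ ρ.real {x | f x ∈ J} := by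
      refine measureReal_mono fun x (hx : cdf ρ x < sSup J - δ) => ?_
      have := (abs_le.1 (h x)).2
      obtain ⟨y, hy, hxy⟩ := exists_lt_of_lt_csSup ⟨0, hJ0⟩ (by linarith : f x < sSup J)
      exact hJl y hy _ (hf x) hxy.le
    linarith
  · have h1 := measureReal_cdf_le_le ρ (v := sSup J + δ) (by linarith)
    have h2 : ρ.real {x | f x ∈ J} ≤ ρ.real {x | cdf ρ x ≤ sSup J + δ} := by
      refine measureReal_mono fun x (hx : f x ∈ J) => ?_
      have := (abs_le.1 (h x)).1
      have := le_csSup hb hx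
      simp only [Set.mem_ofPred_eq]
      linarith
    linarith

/-- Monotonicity brackets `f x` between its values at neighbouring quantiles, where the distribution
function differs by one cell of mass `1 / K`. -/
lemma abs_sub_cdf_le_of_grid {K : ℕ} (hK : 0 < K) {t : ℕ → ℝ}
    (ht : ∀ k, 0 < k → k < K → cdf ρ (t k) = k / K) {f : ℝ → ℝ} (hf : Monotone f)
    (hf0 : ∀ x, 0 ≤ f x) (hf1 : ∀ x, f x ≤ 1) {δ : ℝ} (hδ : 0 ≤ δ)
    (h : ∀ k, 0 < k → k < K → |f (t k) - cdf ρ (t k)| ≤ δ) (x : ℝ) :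
    |f x - cdf ρ x| ≤ δ + 1 / K := by
  have hK' : (0 : ℝ) < K := by exact_mod_cast hK
  have hF0 := cdf_nonneg ρ x
  have hF1 := cdf_le_one ρ x
  have hinv : 0 < 1 / (K : ℝ) := by positivity
  have hfl := Nat.floor_le (mul_nonneg hK'.le hF0)
  have hfl' := Nat.lt_floor_add_one (K * cdf ρ x)
  rw [abs_le]
  constructor
  -- Ceiling minus one, not floor: the grid level must be strictly below `cdf ρ x` to force `t k ≤
  -- x`. At level zero there is no grid point and `0 ≤ f` suffices.
  · rcases Nat.eq_zero_or_pos (⌈K * cdf ρ x⌉₊ - 1) with h0 | h0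
    · have h1 : K * cdf ρ x ≤ 1 := by
        have : ⌈K * cdf ρ x⌉₊ ≤ 1 := by omega
        exact_mod_cast Nat.ceil_le.1 this
      have : cdf ρ x ≤ 1 / K := by rw [le_div_iff₀ hK']; linarith
      linarith [hf0 x]
    · set k := ⌈K * cdf ρ x⌉₊ - 1 with hk
      have hlt : (k : ℝ) < K * cdf ρ x := Nat.lt_ceil.1 (by omega)
      have hge : K * cdf ρ x ≤ k + 1 := by
        have : ⌈K * cdf ρ x⌉₊ ≤ k + 1 := by omega
        exact_mod_cast Nat.ceil_le.1 this
      have hkK : k < K := by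
        have : (k : ℝ) < K := hlt.trans_le (by nlinarith)
        exact_mod_cast this
      have h1 := ht k h0 hkK
      have h2 := (abs_le.1 (h k h0 hkK)).1
      have h3 : (k : ℝ) / K < cdf ρ x := by rw [div_lt_iff₀ hK']; linarith
      have h4 : cdf ρ x ≤ k / K + 1 / K := by rw [← add_div, le_div_iff₀ hK']; linarith
      have h5 : t k ≤ x := by
        by_contra hx
        have := monotone_cdf ρ (not_le.1 hx).le
        linarith
      have := hf h5
      linarith
  · set k := ⌊K * cdf ρ x⌋₊ + 1 with hk
    have hlt : K * cdf ρ x < k := by rw [hk]; push_cast; exact hfl'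
    have hge : (k : ℝ) ≤ K * cdf ρ x + 1 := by rw [hk]; push_cast; linarith
    have h4 : (k : ℝ) / K ≤ cdf ρ x + 1 / K := by
      rw [div_le_iff₀ hK', add_mul, one_div_mul_cancel hK'.ne']; linarith
    rcases Nat.lt_or_ge k K with hkK | hkK
    · have h1 := ht k (by omega) hkK
      have h2 := (abs_le.1 (h k (by omega) hkK)).2
      have h3 : cdf ρ x < k / K := by rw [lt_div_iff₀ hK']; linarith
      have h5 : x ≤ t k := by
        by_contra hx
        have := monotone_cdf ρ (not_le.1 hx).le
        linarith
      have := hf h5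
      linarith
    · have : (1 : ℝ) ≤ k / K := by rw [le_div_iff₀ hK']; simpa using (by exact_mod_cast hkK)
      linarith [hf1 x]

end RealLine

/-! ### Empirical distribution functions -/

section EmpCDF

variable {ι : Type*} (I : Finset ι) (z : ι → ℝ)

lemma empCDF_nonneg (t : ℝ) : 0 ≤ empCDF I z t := by unfold empCDF; positivity

lemma empCDF_le_one (t : ℝ) : empCDF I z t ≤ 1 :=
  div_le_one_of_le₀ (by exact_mod_cast Finset.card_filter_le _ _) (by positivity)

lemma monotone_empCDF : Monotone (empCDF I z) := fun s t hst => by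
  unfold empCDF
  gcongr with i hi

end EmpCDF

/-! ### The expected uniform distance on a random subsample -/

section Uniform

variable {ι Ω : Type*} [Fintype ι] [DecidableEq ι]

/-- The normalised weights of the subsample `H B`. -/
def halfWeight (H : Finset ι → Finset ι) (i : ι) (B : Finset ι) : ℝ :=
  if i ∈ H B then (√((H B).card + 1))⁻¹ else 0

lemma sum_halfWeight_sq_le (H : Finset ι → Finset ι) (B : Finset ι) :
    ∑ i, halfWeight H i B ^ 2 ≤ 1 := by
  have : ∀ i, halfWeight H i B ^ 2 = if i ∈ H B then (((H B).card : ℝ) + 1)⁻¹ else 0 := fun i => by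
    unfold halfWeight
    split_ifs
    · rw [inv_pow, Real.sq_sqrt (by positivity)]
    · simp
  simp only [this, Finset.sum_ite_mem, Finset.univ_inter, Finset.sum_const, nsmul_eq_mul]
  rw [← div_eq_mul_inv, div_le_one (by positivity)]
  linarith

-- The process equals `(m+1)^{-1/2} (m - c / r)` for `c` hits among `m`, so the deviation is `r
-- (m+1)^{1/2} / m` times it; the factor `2` comes from `m + 1 ≤ 2m`, which needs a nonempty half.
open Classical in
lemma abs_freq_sub_le (A C : Set Ω) {r : ℝ} (hr0 : 0 < r) (hr1 : r ≤ 1)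
    (H : Finset ι → Finset ι) (ω : ι → Ω) (hne : (H (hitSet A ω)).Nonempty) :
    |(((H (hitSet A ω)).filter fun i => ω i ∈ C).card : ℝ) / (H (hitSet A ω)).card - r|
      ≤ 2 * (√((H (hitSet A ω)).card + 1))⁻¹ * |wProc A C r (halfWeight H) ω| := by
  set I := H (hitSet A ω) with hI
  set u := (√((I.card : ℝ) + 1))⁻¹ with hu
  have hm : (1 : ℝ) ≤ I.card := by exact_mod_cast hne.card_pos
  have hu0 : 0 < u := by positivity
  have hu2 : u ^ 2 * (I.card + 1) = 1 := by
    rw [hu, inv_pow, Real.sq_sqrt (by positivity), inv_mul_cancel₀ (by positivity)]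
  set c : ℝ := ((I.filter fun i => ω i ∈ C).card : ℝ) with hc
  have hW : wProc A C r (halfWeight H) ω = u * (I.card - c / r) := by
    unfold wProc halfWeight
    simp only [← hI, ← hu, ite_mul, zero_mul, Finset.sum_ite_mem, Finset.univ_inter]
    rw [← Finset.mul_sum, Finset.sum_sub_distrib, ← Finset.sum_div]
    congr 3
    · simp
    · rw [hc, Finset.card_filter]
      push_cast
      exact Finset.sum_congr rfl fun i _ => by simp [Set.indicator_apply]
  have e : c / I.card - r = -(r * (I.card - c / r) / I.card) := by
    field_simp
    ring
  rw [e, hW, abs_neg, abs_div, abs_mul, abs_mul, abs_of_pos hr0, abs_of_pos hu0,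
    abs_of_pos (by linarith : (0 : ℝ) < I.card), div_le_iff₀ (by linarith)]
  have h1 : 1 ≤ 2 * u * u * I.card := by nlinarith [sq_nonneg u]
  have h2 := abs_nonneg ((I.card : ℝ) - c / r)
  nlinarith

variable [MeasurableSpace Ω]

/-- A half of size `m` in a group of size at most `2m + 1` satisfies `1 / (m + 1) ≤ 2 / (|B| + 1)`.
-/
lemma integral_inv_card_half_le (μ : Measure Ω) [IsProbabilityMeasure μ] [Nonempty ι] {A : Set Ω}
    (hA : MeasurableSet A) (hA0 : 0 < μ.real A) {H : Finset ι → Finset ι}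
    (hHc : ∀ B, B.card ≤ 2 * (H B).card + 1) :
    ∫ ω : ι → Ω, ((√((H (hitSet A ω)).card + 1))⁻¹) ^ 2 ∂(Measure.pi fun _ : ι => μ)
      ≤ 2 / (Fintype.card ι * μ.real A) := by
  rw [div_eq_mul_inv]
  refine le_trans ?_ (mul_le_mul_of_nonneg_left (integral_inv_card_hitSet_le μ hA hA0) zero_le_two)
  rw [← integral_const_mul]
  have hb : ∀ m : ℕ, |((m : ℝ) + 1)⁻¹| ≤ 1 := fun m => by
    rw [abs_of_pos (by positivity)]
    exact inv_le_one_of_one_le₀ (by simp)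
  refine integral_mono ?_ ?_ fun ω => ?_
  · refine integrable_of_abs_le _ (c := 1) (measurable_hitSet_comp hA
      fun B => ((√((H B).card + 1))⁻¹) ^ 2) fun ω => ?_
    rw [inv_pow, Real.sq_sqrt (by positivity)]
    exact hb _
  · exact (integrable_of_abs_le _ (c := 1) (measurable_hitSet_comp hA
      fun B => ((B.card : ℝ) + 1)⁻¹) fun ω => hb _).const_mul 2
  · simp only
    rw [inv_pow, Real.sq_sqrt (by positivity), ← div_eq_mul_inv, inv_eq_one_div,
      div_le_div_iff₀ (by positivity) (by positivity)]
    have : ((hitSet A ω).card : ℝ) ≤ 2 * (H (hitSet A ω)).card + 1 := by exact_mod_cast hHc _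
    linarith

open Classical in
/-- Along a decreasing sequence of sets, the relative frequencies in a random subsample are
uniformly close to the probabilities, on average. -/
lemma exists_bound_antitone (μ : Measure Ω) [IsProbabilityMeasure μ] [Nonempty ι] {A : Set Ω}
    {C : ℕ → Set Ω} (hA : MeasurableSet A) (hC : ∀ k, MeasurableSet (C k)) (hCa : Antitone C)
    (hA0 : 0 < μ.real A) {r : ℕ → ℝ} (hr : ∀ k, 1 / 2 ≤ r k) (hr1 : ∀ k, r k ≤ 1)
    (h : ∀ k, μ.real (A ∩ C k) = r k * μ.real A) {H : Finset ι → Finset ι} (hH : ∀ B, H B ⊆ B)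
    (hHc : ∀ B, B.card ≤ 2 * (H B).card + 1) (K : ℕ) :
    ∃ R : (ι → Ω) → ℝ, Integrable R (Measure.pi fun _ : ι => μ) ∧ (∀ ω, 0 ≤ R ω) ∧
      ∫ ω, R ω ∂(Measure.pi fun _ : ι => μ) ≤ 12 / √(Fintype.card ι * μ.real A) ∧
      ∀ ω, (H (hitSet A ω)).Nonempty → ∀ k ≤ K,
        |(((H (hitSet A ω)).filter fun i => ω i ∈ C k).card : ℝ) / (H (hitSet A ω)).card - r k|
          ≤ R ω := by
  set π := Measure.pi fun _ : ι => μ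
  set l := √(Fintype.card ι * μ.real A) with hl
  have hcard : (0 : ℝ) < Fintype.card ι := by exact_mod_cast Fintype.card_pos
  have hl0 : 0 < l := Real.sqrt_pos.2 (mul_pos hcard hA0)
  have hl2 : l ^ 2 = Fintype.card ι * μ.real A := Real.sq_sqrt (mul_pos hcard hA0).le
  have hr0 : ∀ k, 0 < r k := fun k => by linarith [hr k]
  let u : (ι → Ω) → ℝ := fun ω => (√((H (hitSet A ω)).card + 1))⁻¹
  have hum : Measurable u := measurable_hitSet_comp hA fun B => (√((H B).card + 1))⁻¹
  have hu0 : ∀ ω, 0 < u ω := fun ω => by positivity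
  have hu1 : ∀ ω, u ω ≤ 1 := fun ω => inv_le_one_of_one_le₀ (by
    rw [Real.one_le_sqrt]; simp)
  have hua : ∀ ω, |u ω| ≤ 1 := fun ω => by rw [abs_of_pos (hu0 ω)]; exact hu1 ω
  have hu2 : ∫ ω, u ω ^ 2 ∂π ≤ 2 / l ^ 2 := by
    rw [hl2]; exact integral_inv_card_half_le μ hA hA0 hHc
  have hu2i : Integrable (fun ω => u ω ^ 2) π :=
    integrable_of_abs_le π (c := 1) (hum.pow_const 2) fun ω => by
      rw [abs_pow]; exact pow_le_one₀ (abs_nonneg _) (hua ω)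
  have one_sided : ∀ V : ι → Finset ι → ℝ, (∀ i B, i ∉ B → V i B = 0) →
      (∀ B, ∑ i, V i B ^ 2 ≤ 1) →
      Integrable (fun ω => 2 * u ω * runMax (fun k => wProc A (C k) (r k) V ω) K) π ∧
      ∫ ω, 2 * u ω * runMax (fun k => wProc A (C k) (r k) V ω) K ∂π ≤ 6 / l := by
    intro V hV0 hV
    have hMm := measurable_runMax (fun k => measurable_wProc hA (hC k) (r k) V) K
    have hMb : ∀ ω, |runMax (fun k => wProc A (C k) (r k) V ω) K| ≤ Fintype.card ι := fun ω => by
      rw [abs_of_nonneg (runMax_nonneg _ _)]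
      exact runMax_le (by positivity)
        (fun j => (le_abs_self _).trans (abs_wProc_le A (C j) (hr j) hV ω)) K
    have hM2i : Integrable (fun ω => runMax (fun k => wProc A (C k) (r k) V ω) K ^ 2) π :=
      integrable_of_abs_le π (c := (Fintype.card ι : ℝ) ^ 2) (hMm.pow_const 2) fun ω => by
        rw [abs_pow]; exact pow_le_pow_left₀ (abs_nonneg _) (hMb ω) 2
    have hi : Integrable (fun ω => 2 * u ω * runMax (fun k => wProc A (C k) (r k) V ω) K) π := by
      refine integrable_of_abs_le π (c := 2 * 1 * Fintype.card ι) ((hum.const_mul 2).mul hMm)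
        fun ω => ?_
      rw [abs_mul, abs_mul, abs_two]
      gcongr
      · exact hua ω
      · exact hMb ω
    refine ⟨hi, ?_⟩
    have hM2 := integral_runMax_wProc_sq_le μ hA hC hCa hA0 hr h hV0 hV K
    -- The weighted inequality `2uM ≤ l u² + M² / l` takes the place of Cauchy–Schwarz; with `E u² ≤
    -- 2 / l²` and `E M² ≤ 4` it gives `6 / l`.
    calc ∫ ω, 2 * u ω * runMax (fun k => wProc A (C k) (r k) V ω) K ∂π
        ≤ ∫ ω, (l * u ω ^ 2 + l⁻¹ * runMax (fun k => wProc A (C k) (r k) V ω) K ^ 2) ∂π := by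
          refine integral_mono hi ((hu2i.const_mul l).add (hM2i.const_mul l⁻¹)) fun ω => ?_
          have := mul_nonneg (inv_pos.2 hl0).le
            (sq_nonneg (l * u ω - runMax (fun k => wProc A (C k) (r k) V ω) K))
          have e : l⁻¹ * (l * u ω - runMax (fun k => wProc A (C k) (r k) V ω) K) ^ 2
              = l * u ω ^ 2 + l⁻¹ * runMax (fun k => wProc A (C k) (r k) V ω) K ^ 2
                - 2 * u ω * runMax (fun k => wProc A (C k) (r k) V ω) K := by
            field_simp
            ring
          simp only
          linarith
      _ = l * ∫ ω, u ω ^ 2 ∂π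
          + l⁻¹ * ∫ ω, runMax (fun k => wProc A (C k) (r k) V ω) K ^ 2 ∂π := by
          rw [integral_add (hu2i.const_mul l) (hM2i.const_mul l⁻¹), integral_const_mul,
            integral_const_mul]
      _ ≤ l * (2 / l ^ 2) + l⁻¹ * 4 := by gcongr
      _ = 6 / l := by field_simp; norm_num
  have hV0 : ∀ i B, i ∉ B → halfWeight H i B = 0 := fun i B hi =>
    if_neg fun h' => hi (hH B h')
  obtain ⟨i1, b1⟩ := one_sided (halfWeight H) hV0 (sum_halfWeight_sq_le H)
  -- The running maximum is one-sided; opposite weights control the minimum and double the constant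
  -- to `12`.
  obtain ⟨i2, b2⟩ := one_sided (fun i B => - halfWeight H i B)
    (fun i B hi => by simp [hV0 i B hi]) (fun B => by simpa using sum_halfWeight_sq_le H B)
  refine ⟨_, i1.add i2, fun ω => ?_, ?_, fun ω hne k hk => ?_⟩
  · have := hu0 ω
    exact add_nonneg (mul_nonneg (by linarith) (runMax_nonneg _ _))
      (mul_nonneg (by linarith) (runMax_nonneg _ _))
  · refine (integral_add i1 i2).trans_le ((add_le_add b1 b2).trans_eq ?_)
    ring
  · refine (abs_freq_sub_le A (C k) (hr0 k) (hr1 k) H ω hne).trans ?_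
    simp only [Pi.add_apply]
    rw [← mul_add]
    refine mul_le_mul_of_nonneg_left ?_ (by positivity)
    have h1 := le_runMax (fun k => wProc A (C k) (r k) (halfWeight H) ω) hk
    have h2 := le_runMax (fun k => wProc A (C k) (r k) (fun i B => - halfWeight H i B) ω) hk
    have h3 := runMax_nonneg (fun k => wProc A (C k) (r k) (halfWeight H) ω) K
    have h4 := runMax_nonneg (fun k => wProc A (C k) (r k) (fun i B => - halfWeight H i B) ω) K
    rw [wProc_neg] at h2
    rw [abs_le]
    constructor <;> linarith

/-- The expected uniform distance between the empirical distribution function of a random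
subsample and an atomless distribution function, without logarithmic factors. -/
theorem exists_bound_abs_empCDF_sub_cdf (μ : Measure Ω) [IsProbabilityMeasure μ] [Nonempty ι]
    {A : Set Ω} (hA : MeasurableSet A) (hA0 : 0 < μ.real A) {z : Ω → ℝ} (hz : Measurable z)
    (ρ : Measure ℝ) [IsProbabilityMeasure ρ] [NullSingletonClass ρ]
    (hρ : ∀ E, MeasurableSet E → μ.real (A ∩ z ⁻¹' E) = ρ.real E * μ.real A)
    {H : Finset ι → Finset ι} (hH : ∀ B, H B ⊆ B) (hHc : ∀ B, B.card ≤ 2 * (H B).card + 1) :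
    ∃ δ : (ι → Ω) → ℝ, Integrable δ (Measure.pi fun _ : ι => μ) ∧
      ∫ ω, δ ω ∂(Measure.pi fun _ : ι => μ) ≤ 26 / √(Fintype.card ι * μ.real A) ∧
      ∀ ω x, |empCDF (H (hitSet A ω)) (fun i => z (ω i)) x - cdf ρ x| ≤ δ ω := by
  classical
  set π := Measure.pi fun _ : ι => μ
  set N := Fintype.card ι with hN
  set l := √(N * μ.real A) with hl
  have hNpos : 0 < N := Fintype.card_pos
  have hcard : (0 : ℝ) < N := by exact_mod_cast hNpos
  have hl0 : 0 < l := Real.sqrt_pos.2 (mul_pos hcard hA0)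
  have hl2 : l ^ 2 = N * μ.real A := Real.sq_sqrt (mul_pos hcard hA0).le
  -- Levels `0` and `1` need not be attained, so the quantile property is asked only at interior
  -- indices.
  have hgrid : ∀ k : ℕ, ∃ x, 0 < k → k < 2 * N → cdf ρ x = k / (2 * N : ℕ) := by
    intro k
    by_cases hk : 0 < k ∧ k < 2 * N
    · have h2 : (0 : ℝ) < (2 * N : ℕ) := by exact_mod_cast (by omega : 0 < 2 * N)
      obtain ⟨x, hx⟩ := exists_cdf_eq ρ (v := k / (2 * N : ℕ))
        (div_pos (by exact_mod_cast hk.1) h2)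
        ((div_lt_one h2).2 (by exact_mod_cast hk.2))
      exact ⟨x, fun _ _ => hx⟩
    · exact ⟨0, fun h1 h2 => absurd ⟨h1, h2⟩ hk⟩
  choose t ht using hgrid
  have htm : ∀ j k, 0 < j → j ≤ k → k < 2 * N → t j ≤ t k := by
    intro j k hj hjk hk
    rcases hjk.eq_or_lt with rfl | hjk
    · exact le_rfl
    by_contra hlt
    have h1 := monotone_cdf ρ (not_le.1 hlt).le
    rw [ht j hj (by omega), ht k (by omega) hk,
      div_le_div_iff_of_pos_right (by exact_mod_cast (by omega : 0 < 2 * N))] at h1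
    have : j ≤ k := hjk.le
    have h2 : (k : ℝ) ≤ j := h1
    have : k ≤ j := by exact_mod_cast h2
    omega
  have hcdf : ∀ x, ρ.real (Set.Iic x) = cdf ρ x := fun x => (cdf_eq_real ρ x).symm
  have hcdf' : ∀ x, ρ.real (Set.Ioi x) = 1 - cdf ρ x := fun x => by
    rw [← hcdf, ← Set.compl_Iic, probReal_compl_eq_one_sub measurableSet_Iic]
  have h2N : (0 : ℝ) < (2 * N : ℕ) := by exact_mod_cast (by omega : 0 < 2 * N)
  -- Upper rays moving right as far as the median `t N`, where the sequence is frozen so that `r k ≥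
  -- 1/2` for every `k`. The shift by one skips the meaningless `t 0`.
  obtain ⟨R₁, hR₁i, hR₁0, hR₁, hR₁b⟩ := exists_bound_antitone μ (K := N) hA
    (C := fun k => z ⁻¹' Set.Ioi (t (min (k + 1) N)))
    (r := fun k => ρ.real (Set.Ioi (t (min (k + 1) N))))
    (fun k => hz measurableSet_Ioi)
    (fun j k hjk => Set.preimage_mono (Set.Ioi_subset_Ioi
      (htm _ _ (by omega) (by omega) (by omega))))
    hA0 (fun k => by
      rw [hcdf', ht _ (by omega) (by omega)]
      have h1 : ((min (k + 1) N : ℕ) : ℝ) ≤ N := by exact_mod_cast min_le_right _ _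
      have : ((min (k + 1) N : ℕ) : ℝ) / (2 * N : ℕ) ≤ 1 / 2 := by
        rw [div_le_iff₀ h2N]; push_cast at *; linarith
      linarith)
    (fun k => measureReal_le_one) (fun k => hρ _ measurableSet_Ioi) hH hHc
  -- The mirror image: lower rays moving left from `t (2N - 1)` to the median.
  obtain ⟨R₂, hR₂i, hR₂0, hR₂, hR₂b⟩ := exists_bound_antitone μ (K := N) hA
    (C := fun k => z ⁻¹' Set.Iic (t (2 * N - min (k + 1) N)))
    (r := fun k => ρ.real (Set.Iic (t (2 * N - min (k + 1) N))))
    (fun k => hz measurableSet_Iic)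
    (fun j k hjk => Set.preimage_mono (Set.Iic_subset_Iic.2
      (htm _ _ (by omega) (by omega) (by omega))))
    hA0 (fun k => by
      rw [hcdf, ht _ (by omega) (by omega)]
      have h1 : (N : ℝ) ≤ (2 * N - min (k + 1) N : ℕ) := by
        exact_mod_cast (by omega : N ≤ 2 * N - min (k + 1) N)
      rw [le_div_iff₀ h2N]; push_cast at *; linarith)
    (fun k => measureReal_le_one) (fun k => hρ _ measurableSet_Iic) hH hHc
  let u : (ι → Ω) → ℝ := fun ω => (√((H (hitSet A ω)).card + 1))⁻¹
  have hum : Measurable u := measurable_hitSet_comp hA fun B => (√((H B).card + 1))⁻¹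
  have hu0 : ∀ ω, 0 < u ω := fun ω => by positivity
  have hu1 : ∀ ω, u ω ≤ 1 := fun ω => inv_le_one_of_one_le₀ (by
    rw [Real.one_le_sqrt]; simp)
  have hua : ∀ ω, |u ω| ≤ 1 := fun ω => by rw [abs_of_pos (hu0 ω)]; exact hu1 ω
  have hui : Integrable u π := integrable_of_abs_le π hum hua
  have hu2i : Integrable (fun ω => u ω ^ 2) π :=
    integrable_of_abs_le π (c := 1) (hum.pow_const 2) fun ω => by
      rw [abs_pow]; exact pow_le_one₀ (abs_nonneg _) (hua ω)
  have hu : ∫ ω, u ω ∂π ≤ 3 / 2 / l := by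
    have hu2 : ∫ ω, u ω ^ 2 ∂π ≤ 2 / l ^ 2 := by
      rw [hl2]; exact integral_inv_card_half_le μ hA hA0 hHc
    calc ∫ ω, u ω ∂π ≤ ∫ ω, (l / 2 * u ω ^ 2 + 1 / 2 / l) ∂π := by
          refine integral_mono hui ((hu2i.const_mul _).add (integrable_const _)) fun ω => ?_
          have := mul_nonneg (inv_pos.2 hl0).le (sq_nonneg (l * u ω - 1))
          have e : l⁻¹ * (l * u ω - 1) ^ 2
              = 2 * (l / 2 * u ω ^ 2 + 1 / 2 / l - u ω) := by
            field_simp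
            ring
          simp only
          linarith
      _ = l / 2 * ∫ ω, u ω ^ 2 ∂π + 1 / 2 / l := by
          rw [integral_add (hu2i.const_mul _) (integrable_const _), integral_const_mul]
          simp
      _ ≤ l / 2 * (2 / l ^ 2) + 1 / 2 / l := by gcongr
      _ = 3 / 2 / l := by field_simp; norm_num
  have hlN : 1 / ((2 * N : ℕ) : ℝ) ≤ 1 / 2 / l := by
    have h1 : (1 : ℝ) ≤ N := by exact_mod_cast hNpos
    have h2 : l ≤ N := by
      rw [hl, Real.sqrt_le_left (by linarith)]
      nlinarith [measureReal_le_one (μ := μ) (s := A)]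
    rw [div_div]
    push_cast
    gcongr
  -- The term `u` equals `1` when the half is empty and so covers that case; `1 / (2N)` is the grid
  -- error. The constants add up as `12 + 12 + 3/2 + 1/2 = 26`.
  refine ⟨fun ω => (R₁ ω + R₂ ω + u ω) + 1 / (2 * N : ℕ),
    ((hR₁i.add hR₂i).add hui).add (integrable_const _), ?_, fun ω x => ?_⟩
  · have i1 : Integrable (fun ω => R₁ ω + R₂ ω) π := hR₁i.add hR₂i
    have i2 : Integrable (fun ω => R₁ ω + R₂ ω + u ω) π := i1.add hui
    rw [integral_add i2 (integrable_const _), integral_add i1 hui, integral_add hR₁i hR₂i]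
    simp only [integral_const, probReal_univ, smul_eq_mul, one_mul]
    have : 26 / l = 12 / l + 12 / l + 3 / 2 / l + 1 / 2 / l := by field_simp; norm_num
    linarith
  · set I := H (hitSet A ω) with hI
    rcases I.eq_empty_or_nonempty with he | hne
    · have h1 : u ω = 1 := by simp [u, ← hI, he]
      have h2 := hR₁0 ω
      have h3 := hR₂0 ω
      have h4 : 0 < 1 / ((2 * N : ℕ) : ℝ) := by positivity
      have h5 := empCDF_nonneg I (fun i => z (ω i)) x
      have h6 := empCDF_le_one I (fun i => z (ω i)) x
      have h7 := cdf_nonneg ρ x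
      have h8 := cdf_le_one ρ x
      rw [abs_le]
      constructor <;> linarith
    · have hIpos : (0 : ℝ) < I.card := by exact_mod_cast hne.card_pos
      refine abs_sub_cdf_le_of_grid ρ (by omega) ht (monotone_empCDF _ _) (empCDF_nonneg _ _)
        (empCDF_le_one _ _) (add_nonneg (add_nonneg (hR₁0 ω) (hR₂0 ω)) (hu0 ω).le)
        (fun k hk0 hk => ?_) x
      rcases le_or_gt k N with hkN | hkN
      · have h1 := hR₁b ω hne (k - 1) (by omega)
        simp only [show min (k - 1 + 1) N = k by omega, ← hI, hcdf'] at h1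
        have h2 : empCDF I (fun i => z (ω i)) (t k)
            = 1 - ((I.filter fun i => ω i ∈ z ⁻¹' Set.Ioi (t k)).card : ℝ) / I.card := by
          have := Finset.card_filter_add_card_filter_not (s := I) (fun i => z (ω i) ≤ t k)
          simp only [not_le] at this
          have h3 : ((I.filter fun i => z (ω i) ≤ t k).card : ℝ)
              + (I.filter fun i => t k < z (ω i)).card = I.card := by exact_mod_cast this
          unfold empCDF
          simp only [Set.mem_preimage, Set.mem_Ioi]
          rw [eq_sub_iff_add_eq, ← add_div, div_eq_one_iff_eq hIpos.ne']
          exact h3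
        rw [h2]
        have h3 := hR₂0 ω
        have h4 := hu0 ω
        rw [abs_le] at h1 ⊢
        constructor <;> linarith
      · have h1 := hR₂b ω hne (2 * N - k - 1) (by omega)
        simp only [show 2 * N - min (2 * N - k - 1 + 1) N = k by omega, ← hI, hcdf] at h1
        have h2 : empCDF I (fun i => z (ω i)) (t k)
            = ((I.filter fun i => ω i ∈ z ⁻¹' Set.Iic (t k)).card : ℝ) / I.card := by
          simp [empCDF]
        rw [h2]
        have h3 := hR₁0 ω
        have h4 := hu0 ω
        rw [abs_le] at h1 ⊢
        constructor <;> linarith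

end Uniform

/-! ### Laws -/

section Laws

variable {d : ℕ} {S : Type*} [MeasurableSpace S]

lemma isProbabilityMeasure_lawXS (P : Measure (Feat d × S × ℝ)) [IsProbabilityMeasure P] :
    IsProbabilityMeasure (lawXS P) :=
  Measure.isProbabilityMeasure_map (by fun_prop)

lemma isProbabilityMeasure_jitterLaw {σ : ℝ} (hσ : 0 < σ) :
    IsProbabilityMeasure (jitterLaw σ) :=
  cond_isProbabilityMeasure_of_finite (by simp [hσ]) (by simp)

instance nullSingletonClass_jitterLaw (σ : ℝ) : NullSingletonClass (jitterLaw σ) :=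
  ⟨fun x => by
    rw [jitterLaw, cond_apply measurableSet_Icc,
      measure_mono_null Set.inter_subset_right (measure_singleton x), mul_zero]⟩

lemma isProbabilityMeasure_lawXGiven (P : Measure (Feat d × S × ℝ)) [IsProbabilityMeasure P]
    {s : S} (hs : 0 < groupProb P s) : IsProbabilityMeasure (lawXGiven P s) := by
  have : IsProbabilityMeasure (ProbabilityTheory.cond P {z | z.2.1 = s}) :=
    cond_isProbabilityMeasure fun h => by simp [groupProb, measureReal_def, h] at hs
  exact Measure.isProbabilityMeasure_map (by fun_prop)

/-- The conditional law of the jittered score `f X + ε` given the group. -/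
def scoreLaw (P : Measure (Feat d × S × ℝ)) (σ : ℝ) (f : Feat d → ℝ) (s : S) : Measure ℝ :=
  ((lawXGiven P s).prod (jitterLaw σ)).map fun q => f q.1 + q.2

variable (P : Measure (Feat d × S × ℝ)) {σ : ℝ} {f : Feat d → ℝ}

lemma isProbabilityMeasure_scoreLaw [IsProbabilityMeasure P] (hσ : 0 < σ) (hf : Measurable f)
    {s : S} (hs : 0 < groupProb P s) : IsProbabilityMeasure (scoreLaw P σ f s) := by
  have := isProbabilityMeasure_lawXGiven P hs
  have := isProbabilityMeasure_jitterLaw hσ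
  exact Measure.isProbabilityMeasure_map (by fun_prop)

lemma scoreLaw_apply (hσ : 0 < σ) (hf : Measurable f) (s : S) {E : Set ℝ} (hE : MeasurableSet E) :
    scoreLaw P σ f s E = ∫⁻ x, jitterLaw σ {e | f x + e ∈ E} ∂(lawXGiven P s) := by
  have := isProbabilityMeasure_jitterLaw hσ
  have hm : Measurable fun q : Feat d × ℝ => f q.1 + q.2 := by fun_prop
  rw [scoreLaw, Measure.map_apply hm hE, Measure.prod_apply (hm hE)]
  rfl

/-- For fixed features an atom of the score would be an atom of the jitter; this holds whatever the
law of the features. -/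
lemma nullSingletonClass_scoreLaw (hσ : 0 < σ) (hf : Measurable f) (s : S) :
    NullSingletonClass (scoreLaw P σ f s) := by
  refine ⟨fun t => ?_⟩
  rw [scoreLaw_apply P hσ hf s (measurableSet_singleton t)]
  have : ∀ x, jitterLaw σ {e | f x + e ∈ ({t} : Set ℝ)} = 0 := fun x => by
    have h : {e | f x + e ∈ ({t} : Set ℝ)} = {t - f x} := by
      ext e
      simp only [Set.mem_singleton_iff, Set.mem_ofPred_eq]
      constructor <;> intro h <;> linarith
    rw [h, measure_singleton]
  simp_rw [this]
  simp

lemma prod_real_group [MeasurableSingletonClass S] (hσ : 0 < σ) (s : S) :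
    ((lawXS P).prod (jitterLaw σ)).real {w | w.1.2 = s} = groupProb P s := by
  have := isProbabilityMeasure_jitterLaw hσ
  have h : {w : (Feat d × S) × ℝ | w.1.2 = s} = {v : Feat d × S | v.2 = s} ×ˢ Set.univ := by
    ext; simp
  have hm : MeasurableSet {v : Feat d × S | v.2 = s} := measurable_snd (measurableSet_singleton s)
  rw [h, measureReal_def, Measure.prod_prod, measure_univ, mul_one, lawXS,
    Measure.map_apply (by fun_prop) hm]
  rfl

/-- Given membership in the group, the score of an unlabeled observation has law `scoreLaw`, by
Fubini in the jitter; written without division, as the uniform bound requires. -/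
lemma prod_real_group_inter [MeasurableSingletonClass S] [IsProbabilityMeasure P] (hσ : 0 < σ)
    (hf : Measurable f) {s : S} (hs : 0 < groupProb P s) {z : (Feat d × S) × ℝ → ℝ}
    (hz : ∀ w : (Feat d × S) × ℝ, w.1.2 = s → z w = f w.1.1 + w.2) {E : Set ℝ}
    (hE : MeasurableSet E) :
    ((lawXS P).prod (jitterLaw σ)).real ({w | w.1.2 = s} ∩ z ⁻¹' E)
      = (scoreLaw P σ f s).real E * ((lawXS P).prod (jitterLaw σ)).real {w | w.1.2 = s} := by
  have := isProbabilityMeasure_jitterLaw hσ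
  have := isProbabilityMeasure_lawXS P
  rw [prod_real_group P hσ s, groupProb, measureReal_def, measureReal_def, measureReal_def,
    ← ENNReal.toReal_mul]
  congr 1
  set φ : Feat d → ENNReal := fun x => jitterLaw σ {e | f x + e ∈ E} with hφ
  have hm : Measurable fun q : Feat d × ℝ => f q.1 + q.2 := by fun_prop
  have hφm : Measurable φ := measurable_measure_prodMk_left (hm hE)
  have hP : P {z | z.2.1 = s} ≠ 0 := fun h => by simp [groupProb, measureReal_def, h] at hs
  have hA : MeasurableSet {v : Feat d × S | v.2 = s} := measurable_snd (measurableSet_singleton s)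
  have e1 : {w : (Feat d × S) × ℝ | w.1.2 = s} ∩ z ⁻¹' E
      = {w | w.1.2 = s} ∩ (fun w => f w.1.1 + w.2) ⁻¹' E := by
    ext w
    simp only [Set.mem_inter_iff, Set.mem_ofPred_eq, Set.mem_preimage]
    exact and_congr_right fun h => by rw [hz w h]
  have hm2 : MeasurableSet ({w : (Feat d × S) × ℝ | w.1.2 = s} ∩
      (fun w => f w.1.1 + w.2) ⁻¹' E) := by
    refine MeasurableSet.inter ((measurable_snd.comp measurable_fst) (measurableSet_singleton s)) ?_
    have : Measurable fun w : (Feat d × S) × ℝ => f w.1.1 + w.2 := by fun_prop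
    exact this hE
  rw [e1, Measure.prod_apply hm2]
  have e2 : ∀ v : Feat d × S, jitterLaw σ (Prod.mk v ⁻¹' ({w : (Feat d × S) × ℝ | w.1.2 = s} ∩
      (fun w => f w.1.1 + w.2) ⁻¹' E))
      = {v : Feat d × S | v.2 = s}.indicator (fun v => φ v.1) v := by
    intro v
    by_cases hv : v.2 = s
    · rw [Set.indicator_of_mem (by exact hv), hφ]
      congr 1
      ext e
      simp [hv]
    · rw [Set.indicator_of_notMem (by exact hv)]
      convert measure_empty (μ := jitterLaw σ)
      ext e
      simp [hv]
  simp_rw [e2]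
  rw [lintegral_indicator hA, lawXS,
    setLIntegral_map hA
      (show Measurable fun v : Feat d × S => φ v.1 from hφm.comp measurable_fst) (by fun_prop),
    scoreLaw_apply P hσ hf s hE, lawXGiven, lintegral_map hφm (by fun_prop),
    ProbabilityTheory.cond, lintegral_smul_measure, smul_eq_mul, mul_comm _ (P _), ← mul_assoc,
    ENNReal.mul_inv_cancel hP (measure_ne_top _ _), one_mul]
  rfl

end Laws

/-! ### Empirical quantiles -/

section Quantile

variable {ι : Type*}

/-- The empirical distribution function jumps only at observations, so the infimum may be taken over
finitely many points and is attained. -/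
lemma exists_isLeast_empQuantile {I : Finset ι} (hI : I.Nonempty) (z : ι → ℝ) {y : ℝ}
    (hy : y ≤ 1) : ∃ t, IsLeast {t | 0 < empCDF I z t ∧ y ≤ empCDF I z t} t := by
  classical
  set T := {t | 0 < empCDF I z t ∧ y ≤ empCDF I z t} with hT
  have hcard : (0 : ℝ) < I.card := by exact_mod_cast hI.card_pos
  have hdown : ∀ t ∈ T, ∃ i ∈ I, z i ∈ T ∧ z i ≤ t := by
    intro t ht
    have hne : (I.filter fun i => z i ≤ t).Nonempty := by
      rw [Finset.nonempty_iff_ne_empty]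
      intro h
      have := ht.1
      simp [empCDF, h] at this
    obtain ⟨i, hi, hmax⟩ := Finset.exists_max_image _ z hne
    rw [Finset.mem_filter] at hi
    have he : empCDF I z (z i) = empCDF I z t := by
      unfold empCDF
      congr 3
      ext j
      simp only [Finset.mem_filter]
      exact and_congr_right fun hj =>
        ⟨fun h => h.trans hi.2, fun h => hmax j (Finset.mem_filter.2 ⟨hj, h⟩)⟩
    refine ⟨i, hi.1, ?_, hi.2⟩
    simp only [hT, Set.mem_ofPred_eq, he]
    exact ht
  obtain ⟨m, hm, hmax⟩ := Finset.exists_max_image I z hI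
  have hm1 : empCDF I z (z m) = 1 := by
    rw [empCDF, Finset.filter_true_of_mem hmax, div_self hcard.ne']
  have hmT : z m ∈ T := by
    simp only [hT, Set.mem_ofPred_eq, hm1]
    exact ⟨one_pos, hy⟩
  obtain ⟨i, hi, hmin⟩ := Finset.exists_min_image (I.filter fun i => z i ∈ T) z
    ⟨m, Finset.mem_filter.2 ⟨hm, hmT⟩⟩
  rw [Finset.mem_filter] at hi
  refine ⟨z i, hi.2, fun t ht => ?_⟩
  obtain ⟨j, hj, hjT, hjt⟩ := hdown t ht
  exact (hmin j (Finset.mem_filter.2 ⟨hj, hjT⟩)).trans hjt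

lemma empQuantile_le_iff {I : Finset ι} (hI : I.Nonempty) (z : ι → ℝ) {y : ℝ} (hy : y ≤ 1)
    (c : ℝ) : empQuantile I z y ≤ c ↔ 0 < empCDF I z c ∧ y ≤ empCDF I z c := by
  obtain ⟨t, ht⟩ := exists_isLeast_empQuantile hI z hy
  rw [empQuantile, ht.csInf_eq]
  constructor
  · intro h
    have := monotone_empCDF I z h
    exact ⟨ht.1.1.trans_le this, ht.1.2.trans this⟩
  · exact fun h => ht.2 h

/-- The defining set is empty and the real infimum of the empty set is `0`, which is the convention
for empty halves. -/
lemma empQuantile_eq_zero {I : Finset ι} (z : ι → ℝ) {y : ℝ} (h : ¬ (I.Nonempty ∧ y ≤ 1)) :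
    empQuantile I z y = 0 := by
  have : {t | 0 < empCDF I z t ∧ y ≤ empCDF I z t} = ∅ := by
    ext t
    simp only [Set.mem_ofPred_eq, Set.mem_empty_iff_false, iff_false]
    rintro ⟨h1, h2⟩
    refine h ⟨?_, h2.trans (empCDF_le_one I z t)⟩
    rw [Finset.nonempty_iff_ne_empty]
    rintro rfl
    simp [empCDF] at h1
  rw [empQuantile, this, Real.sInf_empty]

lemma empQuantile_mono (I : Finset ι) (z : ι → ℝ) {y y' : ℝ} (h : y' ≤ y) (hy : y ≤ 1) :
    empQuantile I z y' ≤ empQuantile I z y := by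
  rcases I.eq_empty_or_nonempty with rfl | hI
  · rw [empQuantile_eq_zero z (by simp), empQuantile_eq_zero z (by simp)]
  · have := (empQuantile_le_iff hI z hy _).1 le_rfl
    exact (empQuantile_le_iff hI z (h.trans hy) _).2 ⟨this.1, h.trans this.2⟩

variable [Fintype ι] {E : Type*} [MeasurableSpace E]

lemma measurable_empCDF {I : E → Finset ι} (hI : ∀ i, MeasurableSet {e | i ∈ I e})
    {z : E → ι → ℝ} (hz : ∀ i, Measurable fun e => z e i) {t : E → ℝ} (ht : Measurable t) :
    Measurable fun e => empCDF (I e) (z e) (t e) := by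
  classical
  unfold empCDF
  have h1 : ∀ e, (((I e).filter fun i => z e i ≤ t e).card : ℝ)
      = ∑ i, if i ∈ I e ∧ z e i ≤ t e then (1 : ℝ) else 0 := fun e => by
    rw [Finset.sum_boole]
    congr 2
    ext i
    simp
  have h2 : ∀ e, ((I e).card : ℝ) = ∑ i, if i ∈ I e then (1 : ℝ) else 0 := fun e => by
    rw [Finset.sum_boole]
    simp
  simp_rw [h1, h2]
  refine Measurable.div (Finset.measurable_sum _ fun i _ => ?_)
    (Finset.measurable_sum _ fun i _ => ?_)
  · exact Measurable.ite ((hI i).inter (measurableSet_le (hz i) ht)) measurable_const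
      measurable_const
  · exact Measurable.ite (hI i) measurable_const measurable_const

lemma measurable_empQuantile {I : E → Finset ι} (hI : ∀ i, MeasurableSet {e | i ∈ I e})
    {z : E → ι → ℝ} (hz : ∀ i, Measurable fun e => z e i) {y : E → ℝ} (hy : Measurable y) :
    Measurable fun e => empQuantile (I e) (z e) (y e) := by
  refine measurable_of_Iic fun c => ?_
  have hne : MeasurableSet {e | (I e).Nonempty ∧ y e ≤ 1} := by
    have h : {e | (I e).Nonempty} = ⋃ i, {e | i ∈ I e} := by
      ext e
      simp [Finset.Nonempty]
    have h' : MeasurableSet {e | (I e).Nonempty} := h ▸ MeasurableSet.iUnion hI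
    exact h'.inter (measurableSet_le hy measurable_const)
  have hF := measurable_empCDF hI hz (measurable_const (a := c))
  have h : (fun e => empQuantile (I e) (z e) (y e)) ⁻¹' Set.Iic c
      = ({e | (I e).Nonempty ∧ y e ≤ 1} ∩
          {e | 0 < empCDF (I e) (z e) c ∧ y e ≤ empCDF (I e) (z e) c})
        ∪ ({e | (I e).Nonempty ∧ y e ≤ 1}ᶜ ∩ {_e | 0 ≤ c}) := by
    ext e
    by_cases he : (I e).Nonempty ∧ y e ≤ 1
    · simp [he, empQuantile_le_iff he.1 (z e) he.2]
    · simp [he, empQuantile_eq_zero (z e) he]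
  rw [h]
  exact (hne.inter ((measurableSet_lt measurable_const hF).inter (measurableSet_le hy hF))).union
    (hne.compl.inter (MeasurableSet.const _))

end Quantile

/-! ### The halves of a group -/

section Halves

variable {S : Type*}

/-- The members of `B` whose position within `B` is selected by the splitting rule. -/
def firstHalf {N : ℕ} (I₀ : S → ℕ → Finset ℕ) (s : S) (B : Finset (Fin N)) : Finset (Fin N) :=
  B.filter fun i => (B.filter fun j => j < i).card ∈ I₀ s B.card

lemma firstHalf_subset {N : ℕ} (I₀ : S → ℕ → Finset ℕ) (s : S) (B : Finset (Fin N)) :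
    firstHalf I₀ s B ⊆ B := Finset.filter_subset _ _

/-- Ranks are strictly increasing along `B`, hence distinct, and all are below `B.card`. Thus a rule
on positions selects as many members as positions. -/
lemma image_rank_eq_range {N : ℕ} (B : Finset (Fin N)) :
    B.image (fun i => (B.filter fun j => j < i).card) = Finset.range B.card := by
  have hlt : ∀ i ∈ B, ∀ j ∈ B, i < j →
      (B.filter fun k => k < i).card < (B.filter fun k => k < j).card := by
    intro i hi j _ hij
    refine Finset.card_lt_card ⟨fun k hk => ?_, fun h => ?_⟩
    · rw [Finset.mem_filter] at hk ⊢
      exact ⟨hk.1, hk.2.trans hij⟩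
    · have := h (Finset.mem_filter.2 ⟨hi, hij⟩)
      simp at this
  refine Finset.eq_of_subset_of_card_le (fun m hm => ?_) ?_
  · obtain ⟨i, hi, rfl⟩ := Finset.mem_image.1 hm
    rw [Finset.mem_range]
    refine Finset.card_lt_card ⟨Finset.filter_subset _ _, fun h => ?_⟩
    have := h hi
    simp at this
  · rw [Finset.card_range, Finset.card_image_of_injOn]
    intro i hi j hj hij
    rcases lt_trichotomy i j with h | h | h
    · exact absurd hij (hlt i hi j hj h).ne
    · exact h
    · exact absurd hij (hlt j hj i hi h).ne'

lemma card_le_two_mul_card_firstHalf {N : ℕ} {I₀ : S → ℕ → Finset ℕ} (hI : IsHalving I₀) (s : S)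
    (B : Finset (Fin N)) : B.card ≤ 2 * (firstHalf I₀ s B).card + 1 := by
  obtain ⟨h1, h2, -⟩ := hI s B.card
  have : (I₀ s B.card).card ≤ (firstHalf I₀ s B).card := by
    refine (Finset.card_le_card (t := (firstHalf I₀ s B).image
      fun i => (B.filter fun j => j < i).card) fun k hk => ?_).trans Finset.card_image_le
    have hk' := h1 hk
    rw [← image_rank_eq_range, Finset.mem_image] at hk'
    obtain ⟨i, hi, rfl⟩ := hk'
    exact Finset.mem_image.2 ⟨i, Finset.mem_filter.2 ⟨hi, hk⟩, rfl⟩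
  omega

end Halves

/-! ### Measurability of the post-processed estimator -/

section Measurability

variable {d : ℕ} {S : Type*} {n N : ℕ}

lemma groupIdx_eq_hitSet [DecidableEq S] (D : Data d S n N) (s : S) :
    groupIdx D s = hitSet {w : Feat d × S | w.2 = s} D.2.1 := by
  ext i
  simp [groupIdx]

variable [MeasurableSpace S] {fhat : BaseEstimator d S n}

lemma measurable_fhat_group
    (hf : Measurable (fun z : (Fin n → Feat d × S × ℝ) × Feat d × S => fhat z.1 z.2.1 z.2.2))
    (L : Fin n → Feat d × S × ℝ) (s : S) : Measurable fun x => fhat L x s := by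
  have h : Measurable fun x : Feat d => (L, x, s) := by fun_prop
  exact hf.comp h

lemma measurable_score (hf : Measurable (fun z : (Fin n → Feat d × S × ℝ) × Feat d × S =>
      fhat z.1 z.2.1 z.2.2)) (i : Fin N) : Measurable fun D : Data d S n N => score fhat D i := by
  unfold score
  have h : Measurable fun D : Data d S n N => (D.1, (D.2.1 i).1, (D.2.1 i).2) := by fun_prop
  exact (hf.comp h).add (by fun_prop)

variable [MeasurableSingletonClass S] [DecidableEq S]

lemma measurable_groupIdx_comp {β : Type*} [MeasurableSpace β] (s : S)
    (φ : Finset (Fin N) → β) : Measurable fun D : Data d S n N => φ (groupIdx D s) := by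
  simp only [groupIdx_eq_hitSet]
  exact (measurable_hitSet_comp (measurable_snd (measurableSet_singleton s)) φ).comp
    (measurable_fst.comp measurable_snd)

lemma measurableSet_groupIdx (s : S) (p : Finset (Fin N) → Prop) :
    MeasurableSet {D : Data d S n N | p (groupIdx D s)} := by
  classical
  have := measurable_groupIdx_comp (d := d) (n := n) s (fun B : Finset (Fin N) => decide (p B))
    (measurableSet_singleton true)
  simpa [Set.preimage] using this

lemma measurable_ghat [Fintype S]
    (hf : Measurable (fun z : (Fin n → Feat d × S × ℝ) × Feat d × S => fhat z.1 z.2.1 z.2.2))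
    (I₀ : S → ℕ → Finset ℕ) (α p ξ : ℝ) (s : S) :
    Measurable fun e : Data d S n N × Feat d × ℝ => ghat I₀ fhat α p ξ e.1 e.2.1 s e.2.2 := by
  have hsc : ∀ i, Measurable fun e : Data d S n N × Feat d × ℝ => score fhat e.1 i :=
    fun i => (measurable_score hf i).comp measurable_fst
  have hx : Measurable fun e : Data d S n N × Feat d × ℝ => fhat e.1.1 e.2.1 s + e.2.2 := by
    have h : Measurable fun e : Data d S n N × Feat d × ℝ => (e.1.1, e.2.1, s) := by fun_prop
    exact (hf.comp h).add (by fun_prop)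
  have hF : Measurable fun e : Data d S n N × Feat d × ℝ =>
      Fhat I₀ fhat e.1 s (fhat e.1.1 e.2.1 s + e.2.2) :=
    measurable_empCDF (I := fun e : Data d S n N × Feat d × ℝ => half₀ I₀ e.1 s)
      (fun i => measurable_fst (measurableSet_groupIdx s fun B => i ∈ firstHalf I₀ s B)) hsc hx
  have hQ : ∀ s', Measurable fun e : Data d S n N × Feat d × ℝ =>
      Qhat I₀ fhat e.1 s' (Fhat I₀ fhat e.1 s (fhat e.1.1 e.2.1 s + e.2.2)) := fun s' =>
    measurable_empQuantile (I := fun e : Data d S n N × Feat d × ℝ => half₁ I₀ e.1 s')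
      (fun i => measurable_fst (measurableSet_groupIdx s' fun B =>
        i ∈ B.filter fun i => (B.filter fun j => j < i).card ∉ I₀ s' B.card)) hsc hF
  have hp : ∀ s', Measurable fun e : Data d S n N × Feat d × ℝ => phat e.1 s' := fun s' =>
    (measurable_groupIdx_comp s' fun B : Finset (Fin N) => (B.card : ℝ) / N).comp measurable_fst
  unfold ghat Qxi
  exact Measurable.ite (measurableSet_le hF measurable_const) (measurable_const.min (hQ s))
    (measurable_const.max (Finset.measurable_sum _ fun s' _ => (hp s').mul (hQ s')))

/-- Joint measurability of `ghat` in the data, the features and the jitter makes the measures of its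
sections measurable. -/
lemma measurable_predCDF_ghat [Fintype S] {P : Measure (Feat d × S × ℝ)} [IsProbabilityMeasure P]
    {σ : ℝ} (hσ : 0 < σ) (hs : ∀ s, 0 < groupProb P s)
    (hf : Measurable (fun z : (Fin n → Feat d × S × ℝ) × Feat d × S => fhat z.1 z.2.1 z.2.2))
    (I₀ : S → ℕ → Finset ℕ) (α p ξ : ℝ) (s : S) (t : ℝ) :
    Measurable fun D : Data d S n N => predCDF P σ (ghat I₀ fhat α p ξ D) s t := by
  have := isProbabilityMeasure_lawXGiven P (hs s)
  have := isProbabilityMeasure_jitterLaw hσ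
  exact (measurable_measure_prodMk_left
    (measurable_ghat hf I₀ α p ξ s measurableSet_Iic)).ennreal_toReal

end Measurability

/-! ### The tail-unfairness as a supremum -/

section TailUnfairness

variable {d : ℕ} {S : Type*} [MeasurableSpace S] {P : Measure (Feat d × S × ℝ)} {σ : ℝ}

lemma predCDF_nonneg (g : Feat d → S → ℝ → ℝ) (s : S) (t : ℝ) : 0 ≤ predCDF P σ g s t :=
  measureReal_nonneg

lemma tailUnfairness_nonneg (α : ℝ) (g : Feat d → S → ℝ → ℝ) : 0 ≤ tailUnfairness P σ α g :=
  Real.iSup_nonneg fun _ => Real.iSup_nonneg fun _ => Real.iSup_nonneg fun _ => abs_nonneg _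

lemma tailUnfairness_le {α c : ℝ} (hc : 0 ≤ c) {g : Feat d → S → ℝ → ℝ}
    (h : ∀ s s' t, α ≤ t → |predCDF P σ g s t - predCDF P σ g s' t| ≤ c) :
    tailUnfairness P σ α g ≤ c :=
  Real.iSup_le (fun s => Real.iSup_le (fun s' => Real.iSup_le (fun t => h s s' t t.2) hc) hc) hc

variable [IsProbabilityMeasure P]

lemma predCDF_le_one (hσ : 0 < σ) (hs : ∀ s, 0 < groupProb P s) (g : Feat d → S → ℝ → ℝ) (s : S)
    (t : ℝ) : predCDF P σ g s t ≤ 1 := by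
  have := isProbabilityMeasure_lawXGiven P (hs s)
  have := isProbabilityMeasure_jitterLaw hσ
  exact measureReal_le_one

lemma continuousWithinAt_predCDF (hσ : 0 < σ) (hs : ∀ s, 0 < groupProb P s)
    {g : Feat d → S → ℝ → ℝ} {s : S} (hg : Measurable fun q : Feat d × ℝ => g q.1 s q.2) (t : ℝ) :
    ContinuousWithinAt (predCDF P σ g s) (Set.Ici t) t := by
  have := isProbabilityMeasure_lawXGiven P (hs s)
  have := isProbabilityMeasure_jitterLaw hσ
  have hp : IsProbabilityMeasure
      (((lawXGiven P s).prod (jitterLaw σ)).map fun q : Feat d × ℝ => g q.1 s q.2) :=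
    Measure.isProbabilityMeasure_map hg.aemeasurable
  have h : predCDF P σ g s
      = cdf (((lawXGiven P s).prod (jitterLaw σ)).map fun q : Feat d × ℝ => g q.1 s q.2) := by
    ext x
    rw [cdf_eq_real, map_measureReal_apply hg measurableSet_Iic]
    rfl
  rw [h]
  exact StieltjesFunction.right_continuous _ t

lemma abs_predCDF_sub_le_one (hσ : 0 < σ) (hs : ∀ s, 0 < groupProb P s)
    (g : Feat d → S → ℝ → ℝ) (s s' : S) (t : ℝ) :
    |predCDF P σ g s t - predCDF P σ g s' t| ≤ 1 := by
  have h1 := predCDF_nonneg (P := P) (σ := σ) g s t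
  have h2 := predCDF_le_one hσ hs g s t
  have h3 := predCDF_nonneg (P := P) (σ := σ) g s' t
  have h4 := predCDF_le_one hσ hs g s' t
  rw [abs_le]
  constructor <;> linarith

lemma abs_predCDF_sub_le_tailUnfairness (hσ : 0 < σ) (hs : ∀ s, 0 < groupProb P s)
    {α : ℝ} (g : Feat d → S → ℝ → ℝ) (s s' : S) {t : ℝ} (ht : α ≤ t) :
    |predCDF P σ g s t - predCDF P σ g s' t| ≤ tailUnfairness P σ α g := by
  have hb := abs_predCDF_sub_le_one hσ hs g
  have b3 : ∀ s s', BddAbove (Set.range fun t : Set.Ici α =>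
      |predCDF P σ g s t - predCDF P σ g s' t|) := fun s s' =>
    ⟨1, by rintro _ ⟨t, rfl⟩; exact hb s s' t⟩
  have b2 : ∀ s, BddAbove (Set.range fun s' => ⨆ t : Set.Ici α,
      |predCDF P σ g s t - predCDF P σ g s' t|) := fun s =>
    ⟨1, by rintro _ ⟨s', rfl⟩; exact Real.iSup_le (fun t => hb s s' t) zero_le_one⟩
  have b1 : BddAbove (Set.range fun s => ⨆ (s' : S) (t : Set.Ici α),
      |predCDF P σ g s t - predCDF P σ g s' t|) :=
    ⟨1, by
      rintro _ ⟨s, rfl⟩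
      exact Real.iSup_le (fun s' => Real.iSup_le (fun t => hb s s' t) zero_le_one) zero_le_one⟩
  exact ((le_ciSup (b3 s s') ⟨t, ht⟩).trans (le_ciSup (b2 s) s')).trans (le_ciSup b1 s)

/-- Right continuity of the conditional distribution functions reduces the uncountable supremum over
`t` to rational `t`, which yields measurability in the data. -/
lemma tailUnfairness_le_iff_rat (hσ : 0 < σ) (hs : ∀ s, 0 < groupProb P s) {α c : ℝ}
    (hc : 0 ≤ c) {g : Feat d → S → ℝ → ℝ}
    (hg : ∀ s, Measurable fun q : Feat d × ℝ => g q.1 s q.2) :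
    tailUnfairness P σ α g ≤ c ↔ ∀ (s s' : S) (q : ℚ), α ≤ q →
      |predCDF P σ g s q - predCDF P σ g s' q| ≤ c := by
  refine ⟨fun h s s' q hq => (abs_predCDF_sub_le_tailUnfairness hσ hs g s s' hq).trans h,
    fun h => tailUnfairness_le hc fun s s' t ht => ?_⟩
  by_contra hlt
  rw [not_le] at hlt
  have hcont : ContinuousWithinAt (fun t => |predCDF P σ g s t - predCDF P σ g s' t|)
      (Set.Ici t) t :=
    ((continuousWithinAt_predCDF hσ hs (hg s) t).sub
      (continuousWithinAt_predCDF hσ hs (hg s') t)).abs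
  obtain ⟨u, hu, hsub⟩ := mem_nhdsGE_iff_exists_Ico_subset.1 (hcont.eventually_const_lt hlt)
  obtain ⟨q, hq1, hq2⟩ := exists_rat_btwn (Set.mem_Ioi.1 hu)
  have h1 : c < |predCDF P σ g s q - predCDF P σ g s' q| := hsub ⟨hq1.le, hq2⟩
  exact absurd (h s s' q (ht.trans hq1.le)) (not_le.2 h1)

variable [MeasurableSingletonClass S] [DecidableEq S] [Fintype S] {n N : ℕ}
  {fhat : BaseEstimator d S n}

lemma measurable_tailUnfairness_ghat (hσ : 0 < σ) (hs : ∀ s, 0 < groupProb P s)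
    (hf : Measurable (fun z : (Fin n → Feat d × S × ℝ) × Feat d × S => fhat z.1 z.2.1 z.2.2))
    (I₀ : S → ℕ → Finset ℕ) (α p ξ : ℝ) :
    Measurable fun D : Data d S n N => tailUnfairness P σ α (ghat I₀ fhat α p ξ D) := by
  refine measurable_of_Iic fun c => ?_
  rcases lt_or_ge c 0 with hc | hc
  · convert MeasurableSet.empty
    ext D
    simp only [Set.mem_preimage, Set.mem_Iic, Set.mem_empty_iff_false, iff_false, not_le]
    exact hc.trans_le (tailUnfairness_nonneg _ _)
  · have h : (fun D : Data d S n N => tailUnfairness P σ α (ghat I₀ fhat α p ξ D)) ⁻¹' Set.Iic c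
        = ⋂ (s : S) (s' : S) (q : ℚ) (_ : α ≤ q),
          {D | |predCDF P σ (ghat I₀ fhat α p ξ D) s q
            - predCDF P σ (ghat I₀ fhat α p ξ D) s' q| ≤ c} := by
      ext D
      have hg : ∀ s, Measurable fun q : Feat d × ℝ => ghat I₀ fhat α p ξ D q.1 s q.2 := fun s => by
        have h := (measurable_ghat (N := N) hf I₀ α p ξ s).comp (measurable_prodMk_left (x := D))
        exact h
      simp only [Set.mem_preimage, Set.mem_Iic, tailUnfairness_le_iff_rat hσ hs hc hg,
        Set.mem_iInter, Set.mem_ofPred_eq]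
    rw [h]
    refine MeasurableSet.iInter fun s => MeasurableSet.iInter fun s' => MeasurableSet.iInter
      fun q => MeasurableSet.iInter fun _ => ?_
    have h1 := measurable_predCDF_ghat (N := N) hσ hs hf I₀ α p ξ s q
    have h2 := measurable_predCDF_ghat (N := N) hσ hs hf I₀ α p ξ s' q
    exact measurableSet_le (h1.sub h2).abs measurable_const

end TailUnfairness

/-! ### Pointwise bounds for given data -/

section Pointwise

variable {d : ℕ} {S : Type*} [DecidableEq S] [Fintype S] {n N : ℕ} {fhat : BaseEstimator d S n}

/-- The levels at which the post-processed quantile function is at most `t`, for `α ≤ t`. -/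
def levelSet (I₀ : S → ℕ → Finset ℕ) (fhat : BaseEstimator d S n) (α p ξ : ℝ)
    (D : Data d S n N) (t : ℝ) : Set ℝ :=
  {y | y ∈ Set.Icc 0 1 ∧ (y ≤ p ∨ max (α + ξ) (∑ s', phat D s' * Qhat I₀ fhat D s' y) ≤ t)}

/-- The gap `ξ > 0` keeps the upper branch strictly above `α`. -/
lemma levelSet_self {I₀ : S → ℕ → Finset ℕ} {α p ξ : ℝ} (hξ : 0 < ξ) (hp1 : p ≤ 1)
    (D : Data d S n N) : levelSet I₀ fhat α p ξ D α = Set.Icc 0 p := by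
  ext y
  simp only [levelSet, Set.mem_ofPred_eq, Set.mem_Icc]
  constructor
  · rintro ⟨⟨h0, -⟩, h | h⟩
    · exact ⟨h0, h⟩
    · have := (le_max_left _ _).trans h
      linarith
  · rintro ⟨h0, h⟩
    exact ⟨⟨h0, h.trans hp1⟩, Or.inl h⟩

lemma mem_levelSet_of_le {I₀ : S → ℕ → Finset ℕ} {α p ξ t : ℝ} {D : Data d S n N} {y y' : ℝ}
    (hy : y ∈ levelSet I₀ fhat α p ξ D t) (h0 : 0 ≤ y') (h : y' ≤ y) :
    y' ∈ levelSet I₀ fhat α p ξ D t := by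
  obtain ⟨⟨-, h1⟩, h2⟩ := hy
  refine ⟨⟨h0, h.trans h1⟩, h2.imp h.trans fun h2 => (max_le_max le_rfl ?_).trans h2⟩
  refine Finset.sum_le_sum fun s' _ => mul_le_mul_of_nonneg_left (empQuantile_mono _ _ h h1) ?_
  unfold phat
  positivity

/-- The centre `sup J` is common to all groups: in the lower branch `min α _ ≤ α ≤ t` holds
automatically, and the upper branch does not involve `s`. -/
lemma abs_predCDF_ghat_sub_le [MeasurableSpace S] {P : Measure (Feat d × S × ℝ)}
    [IsProbabilityMeasure P] {σ : ℝ} (hσ : 0 < σ) {s : S} (hs : 0 < groupProb P s)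
    {D : Data d S n N}
    (hf : Measurable fun x => fhat D.1 x s) (I₀ : S → ℕ → Finset ℕ) {α p ξ t : ℝ} (hp0 : 0 ≤ p)
    (ht : α ≤ t) {δ : ℝ}
    (hδ : ∀ x, |Fhat I₀ fhat D s x - cdf (scoreLaw P σ (fun x => fhat D.1 x s) s) x| ≤ δ) :
    |predCDF P σ (ghat I₀ fhat α p ξ D) s t - sSup (levelSet I₀ fhat α p ξ D t)| ≤ δ := by
  set J := levelSet I₀ fhat α p ξ D t with hJ
  have := isProbabilityMeasure_scoreLaw P hσ hf hs
  have := nullSingletonClass_scoreLaw P hσ hf s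
  have hF0 : ∀ x, 0 ≤ Fhat I₀ fhat D s x := fun x => empCDF_nonneg _ _ x
  have hF1 : ∀ x, Fhat I₀ fhat D s x ≤ 1 := fun x => empCDF_le_one _ _ x
  have hm : MeasurableSet {x | Fhat I₀ fhat D s x ∈ J} := by
    -- As a lower set of the line this set is an interval, hence measurable.
    have : IsLowerSet {x | Fhat I₀ fhat D s x ∈ J} := fun x y hyx hx =>
      mem_levelSet_of_le hx (hF0 y) (monotone_empCDF _ _ hyx)
    exact this.ordConnected.measurableSet
  have hz : Measurable fun q : Feat d × ℝ => fhat D.1 q.1 s + q.2 :=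
    (hf.comp measurable_fst).add measurable_snd
  have e : predCDF P σ (ghat I₀ fhat α p ξ D) s t
      = (scoreLaw P σ (fun x => fhat D.1 x s) s).real {x | Fhat I₀ fhat D s x ∈ J} := by
    rw [scoreLaw, map_measureReal_apply hz hm, predCDF]
    congr 1
    ext q
    simp only [ghat, Qxi, Set.mem_ofPred_eq, Set.mem_preimage, hJ, levelSet, Set.mem_Icc, hF0, hF1,
      and_self, true_and]
    split_ifs with h
    · simp [h, ht]
    · simp only [h, false_or]
  rw [e]
  refine abs_measureReal_preimage_sub_sSup_le _ (fun y hy => hy.1) ?_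
    (fun y hy y' h0 h => mem_levelSet_of_le hy h0 h) hF0 hδ
  exact ⟨⟨le_rfl, zero_le_one⟩, Or.inl hp0⟩

end Pointwise

/-! ### Integration over the data -/

section Expectation

variable {d : ℕ} {S : Type*} {n N : ℕ}

/-- The data with labeled sample `L` whose unlabeled observations and jitters are listed in `ω`. -/
def mkData (L : Fin n → Feat d × S × ℝ) (ω : Fin N → (Feat d × S) × ℝ) : Data d S n N :=
  (L, fun i => (ω i).1, fun i => (ω i).2)

variable [MeasurableSpace S]

lemma measurable_mkData (L : Fin n → Feat d × S × ℝ) :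
    Measurable fun ω : Fin N → (Feat d × S) × ℝ => mkData L ω := by
  unfold mkData
  fun_prop

variable {P : Measure (Feat d × S × ℝ)} [IsProbabilityMeasure P] {σ : ℝ}

lemma isProbabilityMeasure_dataLaw (hσ : 0 < σ) : IsProbabilityMeasure (dataLaw P σ n N) := by
  have := isProbabilityMeasure_lawXS P
  have := isProbabilityMeasure_jitterLaw hσ
  unfold dataLaw
  infer_instance

/-- With the labeled sample fixed by Fubini, `f̂` is a deterministic function, and each unlabeled
observation paired with its jitter gives an i.i.d. sequence. -/
lemma integral_dataLaw_le (hσ : 0 < σ) {G : Data d S n N → ℝ} (hG : Measurable G) {b : ℝ}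
    (hb : ∀ D, |G D| ≤ b) {c : ℝ}
    (h : ∀ L, ∫ ω, G (mkData L ω)
      ∂(Measure.pi fun _ : Fin N => (lawXS P).prod (jitterLaw σ)) ≤ c) :
    ∫ D, G D ∂(dataLaw P σ n N) ≤ c := by
  have := isProbabilityMeasure_lawXS P
  have := isProbabilityMeasure_jitterLaw hσ
  have := isProbabilityMeasure_dataLaw (P := P) (n := n) (N := N) hσ
  have hi : Integrable G (dataLaw P σ n N) := integrable_of_abs_le _ hG hb
  unfold dataLaw at hi ⊢
  rw [integral_prod _ hi]
  have hmp := measurePreserving_arrowProdEquivProdArrow (Feat d × S) ℝ (Fin N)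
    (fun _ => lawXS P) (fun _ => jitterLaw σ)
  have h' : ∀ L, ∫ y, G (L, y) ∂((Measure.pi fun _ : Fin N => lawXS P).prod
      (Measure.pi fun _ : Fin N => jitterLaw σ)) ≤ c := fun L => by
    rw [← hmp.integral_comp' (g := fun y => G (L, y))]
    exact h L
  calc _ ≤ ∫ _, c ∂(Measure.pi fun _ : Fin n => P) :=
        integral_mono hi.integral_prod_left (integrable_const c) h'
    _ = c := by simp

variable [DecidableEq S] [MeasurableSingletonClass S] {fhat : BaseEstimator d S n}

lemma exists_bound_Fhat (hσ : 0 < σ) (hN : 1 ≤ N) {s : S} (hs : 0 < groupProb P s)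
    (hf : Measurable (fun z : (Fin n → Feat d × S × ℝ) × Feat d × S => fhat z.1 z.2.1 z.2.2))
    {I₀ : S → ℕ → Finset ℕ} (hI : IsHalving I₀) (L : Fin n → Feat d × S × ℝ) :
    ∃ δ : (Fin N → (Feat d × S) × ℝ) → ℝ,
      Integrable δ (Measure.pi fun _ : Fin N => (lawXS P).prod (jitterLaw σ)) ∧
      ∫ ω, δ ω ∂(Measure.pi fun _ : Fin N => (lawXS P).prod (jitterLaw σ))
        ≤ 26 / √(groupProb P s * N) ∧
      ∀ ω x, |Fhat I₀ fhat (mkData L ω) s x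
        - cdf (scoreLaw P σ (fun x => fhat L x s) s) x| ≤ δ ω := by
  have := isProbabilityMeasure_lawXS P
  have := isProbabilityMeasure_jitterLaw hσ
  have : Nonempty (Fin N) := ⟨⟨0, hN⟩⟩
  have hfs : Measurable fun x => fhat L x s := measurable_fhat_group hf L s
  have := isProbabilityMeasure_scoreLaw P hσ hfs hs
  have := nullSingletonClass_scoreLaw P hσ hfs s
  have hz : Measurable fun w : (Feat d × S) × ℝ => fhat L w.1.1 w.1.2 + w.2 := by
    have h : Measurable fun w : (Feat d × S) × ℝ => (L, w.1.1, w.1.2) := by fun_prop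
    exact (hf.comp h).add measurable_snd
  have hA : MeasurableSet {w : (Feat d × S) × ℝ | w.1.2 = s} :=
    (measurable_snd.comp measurable_fst) (measurableSet_singleton s)
  have hpA := prod_real_group P hσ s
  obtain ⟨δ, h1, h2, h3⟩ := exists_bound_abs_empCDF_sub_cdf (ι := Fin N)
    ((lawXS P).prod (jitterLaw σ)) hA (hpA ▸ hs) hz (scoreLaw P σ (fun x => fhat L x s) s)
    (fun E hE => prod_real_group_inter P hσ hfs hs
      (fun w hw => by simp only [hw]) hE)
    (firstHalf_subset I₀ s) (card_le_two_mul_card_firstHalf hI s)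
  refine ⟨δ, h1, ?_, fun ω x => ?_⟩
  · rwa [hpA, Fintype.card_fin, mul_comm] at h2
  · have e : groupIdx (mkData L ω) s = hitSet {w : (Feat d × S) × ℝ | w.1.2 = s} ω := by
      ext i
      rw [groupIdx, Finset.mem_filter, mem_hitSet]
      simp [mkData]
    have := h3 ω x
    rw [← e] at this
    exact this

end Expectation

/-! ### The two expectation bounds -/

section Bounds

variable {d : ℕ} {S : Type*} [Fintype S] [DecidableEq S] [MeasurableSpace S]
  [MeasurableSingletonClass S] {P : Measure (Feat d × S × ℝ)} [IsProbabilityMeasure P]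
  {n N : ℕ} {fhat : BaseEstimator d S n} {I₀ : S → ℕ → Finset ℕ} {σ ξ α p : ℝ}

theorem integral_tailUnfairness_ghat_le (hs : ∀ s, 0 < groupProb P s) (hN : 1 ≤ N)
    (hf : Measurable (fun z : (Fin n → Feat d × S × ℝ) × Feat d × S => fhat z.1 z.2.1 z.2.2))
    (hI : IsHalving I₀) (hσ : 0 < σ) (hp0 : 0 ≤ p) :
    Integrable (fun D => tailUnfairness P σ α (ghat I₀ fhat α p ξ D)) (dataLaw P σ n N) ∧
      ∫ D, tailUnfairness P σ α (ghat I₀ fhat α p ξ D) ∂(dataLaw P σ n N)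
        ≤ (52 * Fintype.card S + 1) / √((⨅ s, groupProb P s) * N) := by
  have := isProbabilityMeasure_lawXS P
  have := isProbabilityMeasure_jitterLaw hσ
  have := isProbabilityMeasure_dataLaw (P := P) (n := n) (N := N) hσ
  have hm := measurable_tailUnfairness_ghat (N := N) hσ hs hf I₀ α p ξ
  have hb : ∀ D : Data d S n N, |tailUnfairness P σ α (ghat I₀ fhat α p ξ D)| ≤ 1 := fun D => by
    rw [abs_of_nonneg (tailUnfairness_nonneg _ _)]
    exact tailUnfairness_le zero_le_one fun s s' t _ => abs_predCDF_sub_le_one hσ hs _ s s' t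
  refine ⟨integrable_of_abs_le _ hm hb, integral_dataLaw_le hσ hm hb fun L => ?_⟩
  choose δ h1 h2 h3 using fun s => exists_bound_Fhat (n := n) hσ hN (hs s) hf hI L
  have hδ0 : ∀ s ω, 0 ≤ δ s ω := fun s ω => (abs_nonneg _).trans (h3 s ω 0)
  have hfs : ∀ s, Measurable fun x => fhat L x s := fun s =>
    measurable_fhat_group hf L s
  -- The factor `2` lets one sum dominate `δ s + δ s'` even when `s = s'`.
  have hpt : ∀ ω, tailUnfairness P σ α (ghat I₀ fhat α p ξ (mkData L ω)) ≤ ∑ s, 2 * δ s ω := by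
    intro ω
    refine tailUnfairness_le (Finset.sum_nonneg fun s _ => by linarith [hδ0 s ω])
      fun s s' t ht => ?_
    have b : ∀ s, 2 * δ s ω ≤ ∑ s, 2 * δ s ω := fun s =>
      Finset.single_le_sum (f := fun s => 2 * δ s ω) (fun s _ => by linarith [hδ0 s ω])
        (Finset.mem_univ s)
    have e := abs_le.1 (abs_predCDF_ghat_sub_le (ξ := ξ) hσ (hs s) (D := mkData L ω) (hfs s) I₀
      hp0 ht (h3 s ω))
    have e' := abs_le.1 (abs_predCDF_ghat_sub_le (ξ := ξ) hσ (hs s') (D := mkData L ω)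
      (hfs s') I₀ hp0 ht (h3 s' ω))
    have := b s
    have := b s'
    rw [abs_le]
    constructor <;> linarith
  -- A probability law exists only if there is some group, so the minimum of the group proportions
  -- is attained and positive.
  obtain ⟨⟨x₀, s₀, y₀⟩⟩ : Nonempty (Feat d × S × ℝ) := nonempty_of_isProbabilityMeasure P
  have : Nonempty S := ⟨s₀⟩
  have hN0 : (0 : ℝ) < N := by exact_mod_cast hN
  have hmin : 0 < ⨅ s, groupProb P s := by
    obtain ⟨s, hs'⟩ := exists_eq_ciInf_of_finite (f := fun s => groupProb P s)
    rw [← hs']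
    exact hs s
  have hl0 : 0 < √((⨅ s, groupProb P s) * N) := Real.sqrt_pos.2 (mul_pos hmin hN0)
  have hδ : ∀ s, ∫ ω, δ s ω ∂(Measure.pi fun _ : Fin N => (lawXS P).prod (jitterLaw σ))
      ≤ 26 / √((⨅ s, groupProb P s) * N) := fun s => by
    refine (h2 s).trans ?_
    gcongr
    exact ciInf_le (Set.finite_range _).bddBelow s
  have hi : ∀ s, Integrable (fun ω => 2 * δ s ω)
      (Measure.pi fun _ : Fin N => (lawXS P).prod (jitterLaw σ)) := fun s => (h1 s).const_mul 2
  calc _ ≤ ∫ ω, ∑ s, 2 * δ s ω ∂(Measure.pi fun _ : Fin N => (lawXS P).prod (jitterLaw σ)) :=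
        integral_mono (integrable_of_abs_le _ (hm.comp (measurable_mkData L)) fun ω => hb _)
          (integrable_finsetSum _ fun s _ => hi s) hpt
    _ = ∑ s, 2 * ∫ ω, δ s ω ∂(Measure.pi fun _ : Fin N => (lawXS P).prod (jitterLaw σ)) := by
        rw [integral_finsetSum _ fun s _ => hi s]
        simp only [integral_const_mul]
    _ ≤ ∑ _s : S, 2 * (26 / √((⨅ s, groupProb P s) * N)) :=
        Finset.sum_le_sum fun s _ => mul_le_mul_of_nonneg_left (hδ s) zero_le_two
    _ = 52 * Fintype.card S / √((⨅ s, groupProb P s) * N) := by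
        rw [Finset.sum_const, Finset.card_univ, nsmul_eq_mul]
        ring
    _ ≤ _ := by
        gcongr
        linarith

theorem integral_abs_predCDF_ghat_sub_le (hs : ∀ s, 0 < groupProb P s) (hN : 1 ≤ N)
    (hf : Measurable (fun z : (Fin n → Feat d × S × ℝ) × Feat d × S => fhat z.1 z.2.1 z.2.2))
    (hI : IsHalving I₀) (hσ : 0 < σ) (hξ : 0 < ξ) (hp0 : 0 ≤ p) (hp1 : p ≤ 1) (s : S) :
    Integrable (fun D => |predCDF P σ (ghat I₀ fhat α p ξ D) s α - p|) (dataLaw P σ n N) ∧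
      ∫ D, |predCDF P σ (ghat I₀ fhat α p ξ D) s α - p| ∂(dataLaw P σ n N)
        ≤ 26 / √(groupProb P s * N) := by
  have := isProbabilityMeasure_lawXS P
  have := isProbabilityMeasure_jitterLaw hσ
  have := isProbabilityMeasure_dataLaw (P := P) (n := n) (N := N) hσ
  have hm : Measurable fun D : Data d S n N => |predCDF P σ (ghat I₀ fhat α p ξ D) s α - p| :=
    ((measurable_predCDF_ghat hσ hs hf I₀ α p ξ s α).sub_const p).abs
  have hb : ∀ D : Data d S n N, |(|predCDF P σ (ghat I₀ fhat α p ξ D) s α - p|)| ≤ 1 := fun D => by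
    rw [abs_abs, abs_le]
    have h1 := predCDF_nonneg (P := P) (σ := σ) (ghat I₀ fhat α p ξ D) s α
    have h2 := predCDF_le_one hσ hs (ghat I₀ fhat α p ξ D) s α
    constructor <;> linarith
  refine ⟨integrable_of_abs_le _ hm hb, integral_dataLaw_le hσ hm hb fun L => ?_⟩
  obtain ⟨δ, h1, h2, h3⟩ := exists_bound_Fhat (n := n) hσ hN (hs s) hf hI L
  have hfs : Measurable fun x => fhat L x s := measurable_fhat_group hf L s
  refine (integral_mono (integrable_of_abs_le _ (hm.comp (measurable_mkData L)) fun ω => hb _) h1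
    fun ω => ?_).trans h2
  have := abs_predCDF_ghat_sub_le (α := α) (ξ := ξ) hσ (hs s) (D := mkData L ω) hfs I₀ hp0
    le_rfl (h3 ω)
  rw [levelSet_self hξ hp1, csSup_Icc hp0] at this
  exact this

end Bounds
end DPTails

end

theorem theorem3 :
    ∃ (C : ℕ → ℝ) (C' : ℝ), (∀ k, 0 < C k) ∧ 0 < C' ∧
      ∀ (d : ℕ) (S : Type*) [Fintype S] [DecidableEq S] [MeasurableSpace S]
        [MeasurableSingletonClass S]
        (P : Measure (DPTails.Feat d × S × ℝ)) [IsProbabilityMeasure P],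
        (∀ s, 0 < DPTails.groupProb P s) →
      ∀ (n N : ℕ), 1 ≤ N →
      ∀ (fhat : DPTails.BaseEstimator d S n),
        Measurable (fun z : (Fin n → DPTails.Feat d × S × ℝ) × DPTails.Feat d × S =>
          fhat z.1 z.2.1 z.2.2) →
      ∀ (I₀ : S → ℕ → Finset ℕ), DPTails.IsHalving I₀ →
      ∀ (σ ξ α p : ℝ), 0 < σ → 0 < ξ → 0 ≤ p → p ≤ 1 →
        (Integrable
            (fun D => DPTails.tailUnfairness P σ α (DPTails.ghat I₀ fhat α p ξ D))
            (DPTails.dataLaw P σ n N) ∧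
          ∫ D, DPTails.tailUnfairness P σ α (DPTails.ghat I₀ fhat α p ξ D)
              ∂(DPTails.dataLaw P σ n N)
            ≤ C (Fintype.card S) / √((⨅ s, DPTails.groupProb P s) * N)) ∧
        ∀ s,
          Integrable
            (fun D => |DPTails.predCDF P σ (DPTails.ghat I₀ fhat α p ξ D) s α - p|)
            (DPTails.dataLaw P σ n N) ∧
          ∫ D, |DPTails.predCDF P σ (DPTails.ghat I₀ fhat α p ξ D) s α - p|
              ∂(DPTails.dataLaw P σ n N)
            ≤ C' / √(DPTails.groupProb P s * N) := by
  -- Each group contributes `2 · 26`; the summand `1` only keeps the constant positive at `k = 0`.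
  refine ⟨fun k => 52 * k + 1, 26, fun k => by positivity, by norm_num, ?_⟩
  intro d S _ _ _ _ P _ hs n N hN fhat hf I₀ hI σ ξ α p hσ hξ hp0 hp1
  exact ⟨DPTails.integral_tailUnfairness_ghat_le hs hN hf hI hσ hp0,
    fun s => DPTails.integral_abs_predCDF_ghat_sub_le hs hN hf hI hσ hξ hp0 hp1 s⟩
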